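/- For $F\subset\binom{[n]}{k}$ let $\gamma_2(F)=\min_{S\in\binom{[n]}{2}}|\{A\in F: A\cap S=\emptyset\}|$ be its double diversity. $F$ is intersecting if $A\cap B\neq\emptyset$ for all $A,B\in F$; an intersecting $F\subset\binom{[n]}{k}$ is saturated if no further $k$-subset of $[n]$ can be added to it without violating the intersecting property. Two families on $[n]$ are isomorphic if a permutation of $[n]$ maps one onto the other. Let $\mathcal L$ be the set of the seven lines $\{1,2,3\},\{1,4,5\},\{1,6,7\},\{2,4,6\},\{2,5,7\},\{3,5,6\},\{3,4,7\}$ of the Fano plane, let $F_{\mathcal L}=\{A\in\binom{[n]}{k}: A\supset L\text{ for some }L\in\mathcal L\}$ be the Fano $k$-graph, and let $\mathcal T_0=\{123,124,345,346,156,256,135,245,146,236\}$. Binomial coefficients with negative lower index are $0$. Theorem. Let $k\ge 3$, $n\ge 13k^2$ and let $F\subset\binom{[n]}{k}$ be intersecting. Then $$\gamma_2(F)\le 2\binom{n-5}{k-3}-\binom{n-7}{k-5}.$$ Moreover, if $k\ge 4$, then ($F$ is saturated and attains equality) if and only if $F$ is isomorphic to the Fano $k$-graph $F_{\mathcal L}$.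 If $k=3$, then ($F$ is saturated and attains equality) if and only if $F$ is isomorphic to $F_{\mathcal L}=\mathcal L$ or to $\mathcal T_0$. -/

import Mathlib

/-- `[n]` is modelled by `Fin n`. `avoiding F S` is the subfamily of all members of `F` that are
disjoint from `S`. -/
def avoiding {n : ℕ} (F : Finset (Finset (Fin n))) (S : Finset (Fin n)) :
    Finset (Finset (Fin n)) :=
  F.filter (fun A => Disjoint A S)

/-- The `l`-diversity: the minimum of `|avoiding F S|` over all `l`-element sets `S`
(a minimum over a nonempty set as soon as `l ≤ n`). -/
noncomputable def diversity {n : ℕ} (l : ℕ) (F : Finset (Finset (Fin n))) : ℕ :=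
  sInf {m : ℕ | ∃ S : Finset (Fin n), S.card = l ∧ m = (avoiding F S).card}

/-- No further `k`-set can be added to `F` without violating the intersecting property. -/
def IsSaturated {n : ℕ} (k : ℕ) (F : Finset (Finset (Fin n))) : Prop :=
  ∀ A : Finset (Fin n), A.card = k →
    ((insert A F : Finset (Finset (Fin n))) : Set (Finset (Fin n))).Intersecting → A ∈ F

/-- Two families on `[n]` are isomorphic if some permutation of `[n]` maps one onto the other. -/
def FamilyIso {n : ℕ} (F G : Finset (Finset (Fin n))) : Prop :=
  ∃ σ : Equiv.Perm (Fin n), F.image (fun A => A.image σ) = G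

/-- The lines of the Fano plane, on the points `0, …, 6`. -/
def fanoLines : Finset (Finset ℕ) :=
  {{0, 1, 2}, {0, 3, 4}, {0, 5, 6}, {1, 3, 5}, {1, 4, 6}, {2, 4, 5}, {2, 3, 6}}

/-- The ten triples of the `2`-`(6,3,2)` design, on the points `0, …, 5`. -/
def designTriples : Finset (Finset ℕ) :=
  {{0, 1, 2}, {0, 1, 3}, {2, 3, 4}, {2, 3, 5}, {0, 4, 5}, {1, 4, 5}, {0, 2, 4}, {1, 3, 4},
    {0, 3, 5}, {1, 2, 5}}

/-- All `k`-subsets of `[n]` that contain at least one member of `E`; here the element of `Fin n`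
with value `i` is identified with the natural number `i`. -/
def generatedFamily (n k : ℕ) (E : Finset (Finset ℕ)) : Finset (Finset (Fin n)) :=
  (Finset.powersetCard k Finset.univ).filter (fun A => ∃ L ∈ E, L ⊆ A.image Fin.val)

/-- The Fano `k`-graph on `[n]`. -/
def fanoGraph (n k : ℕ) : Finset (Finset (Fin n)) := generatedFamily n k fanoLines

/-- The binomial coefficient with integer lower index, equal to `0` when that index is negative. -/
def binom (m : ℕ) (j : ℤ) : ℤ := if j < 0 then 0 else (m.choose j.toNat : ℤ)

/-!
The proof passes to a saturated family `F` and studies its *transversals*, the sets that meet every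
member. Since `n ≥ 2k`, any two transversals with at most `k` points intersect
(`IsSaturated.not_disjoint_of_isTransversal`), and positive double diversity means that no
transversal has fewer than three points. Let `r` be the least size for which no pair of points meets
all transversals with at most `r` points. Then some pair `S` meets all transversals with fewer than
`r` points, and a member of `F` avoiding `S` can be found by branching: three rounds over
transversals with at most `r` points give triples, and each triple disjoint from `S` is extended by
`r - 3` rounds over members of `F`, which leaves at most `k ^ (r - 3) * C(n - r, k - r)` members
above it (`card_above_le_pow_mul_choose`). As `n ≥ 13 k ^ 2`, each such extension gains a
factor `1 / 13`.

For `r ≥ 5` the resulting `r ^ 3` triples contribute too little. For `r = 4` a better choice of `S`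
and of the transversals reduces the number of triples to `2 * 3 * 4`
(`exists_triples_of_card_sdiff_le_two`), which is again too little. For `r = 3` the same branching
gives at most twelve triples, so if at most one three-point transversal avoids `S`, the count is at
most `(1 + 11 / 13) C(n - 3, k - 3)` (`card_avoiding_le_of_subsingleton`), still below the bound.

There remains the case that every pair is avoided by two three-point transversals. These form an
intersecting family of triples, and `exists_fano_or_design` shows that it contains a Fano plane or
the ten triples of the `2`-`(6,3,2)` design. In both configurations each set of points contains a
member or is disjoint from one, so `F` consists of all `k`-sets above the configuration
(`eq_familyAbove_of_isTransversal`). Its double diversity is found by inclusion and exclusion; for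
the design it is smaller than for the Fano plane, except that both are `2` when `k = 3`.
-/

/-! ### Counting sets that contain `L` and avoid `S` -/

theorem card_filter_superset_disjoint {n k : ℕ} (L S : Finset (Fin n)) (h : Disjoint L S)
    (hk : L.card ≤ k) :
    ((Finset.powersetCard k Finset.univ).filter (fun A => L ⊆ A ∧ Disjoint A S)).card =
      (n - (L.card + S.card)).choose (k - L.card) := by
  have himg : (Finset.powersetCard k Finset.univ).filter (fun A => L ⊆ A ∧ Disjoint A S) =
      (Finset.powersetCard (k - L.card) (Finset.univ \ (L ∪ S))).image (fun B => B ∪ L) := by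
    ext A
    simp only [Finset.mem_filter, Finset.mem_powersetCard, Finset.mem_image, Finset.subset_univ,
      true_and]
    constructor
    · rintro ⟨hA, hLA, hAS⟩
      refine ⟨A \ L, ⟨?_, by rw [Finset.card_sdiff_of_subset hLA, hA]⟩,
        Finset.sdiff_union_of_subset hLA⟩
      intro x hx
      have hxS : x ∉ S := fun hs => Finset.disjoint_left.mp hAS (Finset.mem_sdiff.mp hx).1 hs
      simp only [Finset.mem_sdiff, Finset.mem_univ, Finset.mem_union, true_and] at hx ⊢
      tauto
    · rintro ⟨B, ⟨hB, hBk⟩, rfl⟩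
      have h1 : Disjoint B (L ∪ S) := Finset.disjoint_of_subset_left hB Finset.sdiff_disjoint
      rw [Finset.disjoint_union_right] at h1
      refine ⟨by rw [Finset.card_union_of_disjoint h1.1]; omega, Finset.subset_union_right, ?_⟩
      rw [Finset.disjoint_union_left]
      exact ⟨h1.2, h⟩
  rw [himg, Finset.card_image_of_injOn, Finset.card_powersetCard, Finset.card_sdiff_of_subset
    (Finset.subset_univ _), Finset.card_univ, Fintype.card_fin, Finset.card_union_of_disjoint h]
  intro B hB C hC hBC
  have hd : ∀ D ∈ (Finset.powersetCard (k - L.card) (Finset.univ \ (L ∪ S)) :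
      Finset (Finset (Fin n))), (D ∪ L) \ L = D := by
    intro D hD
    have h1 : Disjoint D (L ∪ S) := Finset.disjoint_of_subset_left
      (Finset.mem_powersetCard.mp hD).1 Finset.sdiff_disjoint
    rw [Finset.disjoint_union_right] at h1
    rw [Finset.union_sdiff_right, Finset.sdiff_eq_self_of_disjoint h1.1]
  rw [← hd B hB, ← hd C hC]
  exact congrArg (· \ L) hBC

/-- The same count without a restriction on `|L|`: for `|L| > k` both sides vanish. -/
theorem card_filter_superset_disjoint_eq_binom {n k : ℕ} (L S : Finset (Fin n))
    (h : Disjoint L S) :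
    (((Finset.powersetCard k Finset.univ).filter (fun A => L ⊆ A ∧ Disjoint A S)).card : ℤ) =
      binom (n - (L.card + S.card)) ((k : ℤ) - L.card) := by
  unfold binom
  split_ifs with hlt
  · rw [Finset.card_eq_zero.mpr]
    · rfl
    · rw [Finset.filter_eq_empty_iff]
      rintro A hA ⟨hLA, -⟩
      have := Finset.card_le_card hLA
      rw [(Finset.mem_powersetCard.mp hA).2] at this
      omega
  · rw [card_filter_superset_disjoint L S h (by omega)]
    congr 2
    omega

/-- The members of `F` that contain `X` and avoid `S`. -/
def above {n : ℕ} (F : Finset (Finset (Fin n))) (S X : Finset (Fin n)) :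
    Finset (Finset (Fin n)) :=
  (avoiding F S).filter (fun A => X ⊆ A)

/-- A set that meets every member of `F`. -/
def IsTransversal {n : ℕ} (F : Finset (Finset (Fin n))) (T : Finset (Fin n)) : Prop :=
  ∀ A ∈ F, ¬ Disjoint A T

theorem IsTransversal.mono {n : ℕ} {F : Finset (Finset (Fin n))} {T U : Finset (Fin n)}
    (h : IsTransversal F T) (hTU : T ⊆ U) : IsTransversal F U :=
  fun A hA hd => h A hA (Finset.disjoint_of_subset_right hTU hd)

theorem card_above_le_choose {n k : ℕ} {F : Finset (Finset (Fin n))}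
    (hunif : (F : Set (Finset (Fin n))).Sized k) (S X : Finset (Fin n)) (hX : X.card ≤ k) :
    (above F S X).card ≤ (n - X.card).choose (k - X.card) := by
  have h := card_filter_superset_disjoint X (∅ : Finset (Fin n)) (by simp) hX
  rw [Finset.card_empty, add_zero] at h
  rw [← h]
  apply Finset.card_le_card
  intro A hA
  simp only [above, avoiding, Finset.mem_filter] at hA
  simp only [Finset.mem_filter, Finset.mem_powersetCard, Finset.subset_univ, true_and,
    Finset.disjoint_empty_right, and_true]
  exact ⟨hunif hA.1.1, hA.2⟩

/-- Every member of `F` that avoids `S` and contains `X` meets the transversal `G` outside `S`. -/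
theorem card_above_le_sum {n : ℕ} {F : Finset (Finset (Fin n))} {S X G : Finset (Fin n)}
    (hG : IsTransversal F G) :
    (above F S X).card ≤ ∑ x ∈ G \ S, (above F S (insert x X)).card := by
  refine le_trans (Finset.card_le_card ?_) Finset.card_biUnion_le
  intro A hA
  simp only [above, avoiding, Finset.mem_filter, Finset.mem_biUnion] at hA ⊢
  obtain ⟨x, hxA, hxG⟩ := Finset.not_disjoint_iff.mp (hG A hA.1.1)
  exact ⟨x, Finset.mem_sdiff.mpr ⟨hxG, fun hs => Finset.disjoint_left.mp hA.1.2 hxA hs⟩, hA.1,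
    Finset.insert_subset hxA hA.2⟩

/-- If all transversals disjoint from `S` have at least `|X| + j` points, then branching `j` times
over members of `F` bounds the number of members that contain `X` and avoid `S`. -/
theorem card_above_le_pow_mul_choose {n k : ℕ} {F : Finset (Finset (Fin n))}
    (hunif : (F : Set (Finset (Fin n))).Sized k) (hint : (F : Set (Finset (Fin n))).Intersecting)
    (S : Finset (Fin n)) (j : ℕ) (X : Finset (Fin n)) (hXS : Disjoint X S)
    (hj : X.card + j ≤ k)
    (htr : ∀ Y, IsTransversal F Y → Disjoint Y S → X.card + j ≤ Y.card) :
    (above F S X).card ≤ k ^ j * (n - (X.card + j)).choose (k - (X.card + j)) := by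
  induction j generalizing X with
  | zero => simpa using card_above_le_choose hunif S X (by omega)
  | succ j ih =>
    have hnot : ¬ IsTransversal F X := fun h => by have := htr X h hXS; omega
    simp only [IsTransversal, not_forall, not_not] at hnot
    obtain ⟨G, hG, hGX⟩ := hnot
    have hGt : IsTransversal F G := fun A hA => hint hA hG
    calc (above F S X).card ≤ ∑ x ∈ G \ S, (above F S (insert x X)).card :=
          card_above_le_sum hGt
      _ ≤ ∑ x ∈ G \ S, k ^ j * (n - (X.card + (j + 1))).choose (k - (X.card + (j + 1))) := by
          refine Finset.sum_le_sum fun x hx => ?_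
          rw [Finset.mem_sdiff] at hx
          have hxX : x ∉ X := fun h => Finset.disjoint_left.mp hGX hx.1 h
          have hc := Finset.card_insert_of_notMem hxX
          have := ih (insert x X) (by simp [Finset.disjoint_insert_left, hx.2, hXS])
            (by omega) (fun Y hY hYS => by have := htr Y hY hYS; omega)
          rwa [hc, show X.card + 1 + j = X.card + (j + 1) by ring] at this
      _ = (G \ S).card * (k ^ j * (n - (X.card + (j + 1))).choose (k - (X.card + (j + 1)))) := by
          rw [Finset.sum_const, smul_eq_mul]
      _ ≤ k * (k ^ j * (n - (X.card + (j + 1))).choose (k - (X.card + (j + 1)))) := by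
          gcongr
          rw [← hunif hG]
          exact Finset.card_le_card Finset.sdiff_subset
      _ = _ := by ring

/-! ### Covering by triples -/

theorem card_sdiff_le_of_not_disjoint {n r : ℕ} {T S : Finset (Fin n)} (h : ¬ Disjoint T S)
    (hT : T.card ≤ r + 1) : (T \ S).card ≤ r := by
  obtain ⟨z, hzT, hzS⟩ := Finset.not_disjoint_iff.mp h
  have : (T \ S).card < T.card := Finset.card_lt_card (Finset.ssubset_iff_subset_ne.mpr
    ⟨Finset.sdiff_subset, fun he => by rw [← he] at hzT; exact (Finset.mem_sdiff.mp hzT).2 hzS⟩)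
  omega

/-- If no two points meet all transversals with at most `r` points, three rounds of branching over
such transversals, starting from `T₁`, produce triples one of which lies in each member of `F`
that avoids `S`. The second round has at most `s` branches. -/
theorem exists_triples_of_branching {n : ℕ} {F : Finset (Finset (Fin n))} {r s : ℕ}
    (hcov : ∀ x y : Fin n, ∃ T, IsTransversal F T ∧ T.card ≤ r ∧ x ∉ T ∧ y ∉ T)
    {S T₁ : Finset (Fin n)} (hT₁ : IsTransversal F T₁)
    (hsec : ∀ x ∈ T₁ \ S, ∃ T, IsTransversal F T ∧ x ∉ T ∧ (T \ S).card ≤ s) :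
    ∃ 𝒳 : Finset (Finset (Fin n)), 𝒳.card ≤ (T₁ \ S).card * s * r ∧
      (∀ X ∈ 𝒳, X.card = 3 ∧ Disjoint X S) ∧ ∀ A ∈ avoiding F S, ∃ X ∈ 𝒳, X ⊆ A := by
  choose! T₂ hT₂ hx₂ hc₂ using hsec
  choose T₃ hT₃ hc₃ hx₃ hy₃ using hcov
  refine ⟨(T₁ \ S).biUnion fun x => (T₂ x \ S).biUnion fun y => (T₃ x y \ S).image
    fun z => {x, y, z}, ?_, ?_, ?_⟩
  · rw [mul_assoc]
    refine Finset.card_biUnion_le_card_mul _ _ _ fun x hx => ?_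
    refine le_trans (Finset.card_biUnion_le_card_mul _ _ r fun y _ => ?_)
      (Nat.mul_le_mul_right r (hc₂ x hx))
    exact Finset.card_image_le.trans
      ((Finset.card_le_card Finset.sdiff_subset).trans (hc₃ x y))
  · intro X hX
    simp only [Finset.mem_biUnion, Finset.mem_image] at hX
    obtain ⟨x, hx, y, hy, z, hz, rfl⟩ := hX
    have hxx := hx₂ x hx
    have h1 := hx₃ x y
    have h2 := hy₃ x y
    simp only [Finset.mem_sdiff] at hx hy hz
    refine ⟨Finset.card_eq_three.mpr ⟨x, y, z, ?_, ?_, ?_, rfl⟩, ?_⟩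
    · rintro rfl; exact hxx hy.1
    · rintro rfl; exact h1 hz.1
    · rintro rfl; exact h2 hz.1
    · simp [hx.2, hy.2, hz.2]
  · intro A hA
    simp only [avoiding, Finset.mem_filter] at hA
    have pick : ∀ T, IsTransversal F T → ∃ x ∈ T \ S, x ∈ A := by
      intro T hT
      obtain ⟨x, hxA, hxT⟩ := Finset.not_disjoint_iff.mp (hT A hA.1)
      exact ⟨x, Finset.mem_sdiff.mpr ⟨hxT, fun hs => Finset.disjoint_left.mp hA.2 hxA hs⟩, hxA⟩
    obtain ⟨x, hx, hxA⟩ := pick T₁ hT₁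
    obtain ⟨y, hy, hyA⟩ := pick (T₂ x) (hT₂ x hx)
    obtain ⟨z, hz, hzA⟩ := pick (T₃ x y) (hT₃ x y)
    refine ⟨{x, y, z}, ?_, ?_⟩
    · simp only [Finset.mem_biUnion, Finset.mem_image]
      exact ⟨x, hx, y, hy, z, hz, rfl⟩
    · intro w hw
      simp only [Finset.mem_insert, Finset.mem_singleton] at hw
      rcases hw with rfl | rfl | rfl <;> assumption

/-- When `T₁` has at most two points outside `S`, the second round has at most `r - 1` branches:
were all transversals that miss a point `x` of `T₁ \ S` disjoint from `S`, the set `T₁ \ S`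
would meet all transversals. -/
theorem exists_triples_of_card_sdiff_le_two {n : ℕ} {F : Finset (Finset (Fin n))} {r : ℕ}
    (hcov : ∀ x y : Fin n, ∃ T, IsTransversal F T ∧ T.card ≤ r ∧ x ∉ T ∧ y ∉ T)
    {S T₁ : Finset (Fin n)} (hT₁ : IsTransversal F T₁)
    (hmeet : ∀ T, IsTransversal F T → T.card ≤ r → ¬ Disjoint T₁ T)
    (htwo : (T₁ \ S).card ≤ 2) :
    ∃ 𝒳 : Finset (Finset (Fin n)), 𝒳.card ≤ 2 * (r - 1) * r ∧
      (∀ X ∈ 𝒳, X.card = 3 ∧ Disjoint X S) ∧ ∀ A ∈ avoiding F S, ∃ X ∈ 𝒳, X ⊆ A := by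
  have hsec : ∀ x ∈ T₁ \ S, ∃ T, IsTransversal F T ∧ x ∉ T ∧ (T \ S).card ≤ r - 1 := by
    intro x hx
    by_contra hno
    push Not at hno
    obtain ⟨y, hy⟩ : ∃ y, T₁ \ S ⊆ {x, y} := by
      have h1 : ((T₁ \ S).erase x).card ≤ 1 := by
        rw [Finset.card_erase_of_mem hx]; omega
      have : Nonempty (Fin n) := ⟨x⟩
      obtain ⟨y, hy⟩ := Finset.card_le_one_iff_subset_singleton.mp h1
      refine ⟨y, fun z hz => ?_⟩
      by_cases hzx : z = x
      · simp [hzx]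
      · have := hy (Finset.mem_erase.mpr ⟨hzx, hz⟩)
        simp only [Finset.mem_singleton] at this
        simp [this]
    obtain ⟨T, hT, hTr, hxT, hyT⟩ := hcov x y
    have hlt := hno T hT hxT
    have hTS : Disjoint T S := by
      by_contra hnd
      have := card_sdiff_le_of_not_disjoint (r := r - 1) hnd (by omega)
      omega
    obtain ⟨z, hz1, hzT⟩ := Finset.not_disjoint_iff.mp (hmeet T hT hTr)
    have hz := hy (Finset.mem_sdiff.mpr ⟨hz1, fun hs => Finset.disjoint_left.mp hTS hzT hs⟩)
    simp only [Finset.mem_insert, Finset.mem_singleton] at hz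
    rcases hz with rfl | rfl
    · exact hxT hzT
    · exact hyT hzT
  obtain ⟨𝒳, hc, h⟩ := exists_triples_of_branching hcov hT₁ hsec
  exact ⟨𝒳, hc.trans (by gcongr), h⟩

theorem card_avoiding_le_sum {n : ℕ} {F 𝒳 : Finset (Finset (Fin n))} {S : Finset (Fin n)}
    (h : ∀ A ∈ avoiding F S, ∃ X ∈ 𝒳, X ⊆ A) :
    (avoiding F S).card ≤ ∑ X ∈ 𝒳, (above F S X).card := by
  refine le_trans (Finset.card_le_card fun A hA => ?_) Finset.card_biUnion_le
  obtain ⟨X, hX, hXA⟩ := h A hA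
  exact Finset.mem_biUnion.mpr ⟨X, hX, Finset.mem_filter.mpr ⟨hA, hXA⟩⟩

/-! ### Intersecting families of triples that no pair nearly covers -/

/-- The lines of the Fano plane, as subsets of `Fin 7`. -/
def fanoFin : Finset (Finset (Fin 7)) :=
  {{0, 1, 2}, {0, 3, 4}, {0, 5, 6}, {1, 3, 5}, {1, 4, 6}, {2, 4, 5}, {2, 3, 6}}

/-- The triples of the `2`-`(6,3,2)` design, as subsets of `Fin 6`. -/
def designFin : Finset (Finset (Fin 6)) :=
  {{0, 1, 2}, {0, 1, 3}, {2, 3, 4}, {2, 3, 5}, {0, 4, 5}, {1, 4, 5}, {0, 2, 4}, {1, 3, 4},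
    {0, 3, 5}, {1, 2, 5}}

section Triples

variable {α : Type*} [DecidableEq α]

theorem insert_pair_rotate (a b c : α) : ({a, b, c} : Finset α) = {c, a, b} := by
  rw [Finset.pair_comm b c, Finset.insert_comm]

theorem eq_triple_of_mem {A : Finset α} {a b c : α} (hA : A.card = 3) (ha : a ∈ A) (hb : b ∈ A)
    (hc : c ∈ A) (hab : a ≠ b) (hac : a ≠ c) (hbc : b ≠ c) : A = {a, b, c} := by
  symm
  apply Finset.eq_of_subset_of_card_le
  · intro x hx
    simp only [Finset.mem_insert, Finset.mem_singleton] at hx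
    rcases hx with rfl | rfl | rfl <;> assumption
  · rw [hA, Finset.card_eq_three.mpr ⟨a, b, c, hab, hac, hbc, rfl⟩]

theorem exists_eq_triple_of_mem {A : Finset α} {a : α} (hA : A.card = 3) (ha : a ∈ A) :
    ∃ b c, a ≠ b ∧ a ≠ c ∧ b ≠ c ∧ A = {a, b, c} := by
  obtain ⟨x, y, z, hxy, hxz, hyz, rfl⟩ := Finset.card_eq_three.mp hA
  simp only [Finset.mem_insert, Finset.mem_singleton] at ha
  rcases ha with rfl | rfl | rfl
  · exact ⟨y, z, hxy, hxz, hyz, rfl⟩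
  · exact ⟨x, z, hxy.symm, hyz, hxz, by ext; simp; tauto⟩
  · exact ⟨x, y, hxz.symm, hyz.symm, hxy, by ext; simp; tauto⟩

/-- Two bipartite graphs between `{a, b}` and `{c, d}` with at least two edges each, such that no
edge of one is disjoint from an edge of the other and no point meets all edges of both, are the
two perfect matchings. -/
theorem matchings_of_cross {x1 x2 x3 x4 y1 y2 y3 y4 : Prop}
    (c1 : x1 → ¬ y4) (c2 : x2 → ¬ y3) (c3 : x3 → ¬ y2) (c4 : x4 → ¬ y1)
    (oa : x3 ∨ x4 ∨ y3 ∨ y4) (ob : x1 ∨ x2 ∨ y1 ∨ y2) (oc : x2 ∨ x4 ∨ y2 ∨ y4)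
    (od : x1 ∨ x3 ∨ y1 ∨ y3)
    (hx : x1 ∧ x2 ∨ x1 ∧ x3 ∨ x1 ∧ x4 ∨ x2 ∧ x3 ∨ x2 ∧ x4 ∨ x3 ∧ x4)
    (hy : y1 ∧ y2 ∨ y1 ∧ y3 ∨ y1 ∧ y4 ∨ y2 ∧ y3 ∨ y2 ∧ y4 ∨ y3 ∧ y4) :
    (x1 ∧ x4 ∧ y3 ∧ y2) ∨ (x2 ∧ x3 ∧ y4 ∧ y1) := by
  grind

theorem two_mem_of_four {β : Type*} {T : Set β} {P Q R S A B : β} (hA : A ∈ T) (hB : B ∈ T)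
    (hAB : A ≠ B) (hA' : A = P ∨ A = Q ∨ A = R ∨ A = S) (hB' : B = P ∨ B = Q ∨ B = R ∨ B = S) :
    P ∈ T ∧ Q ∈ T ∨ P ∈ T ∧ R ∈ T ∨ P ∈ T ∧ S ∈ T ∨ Q ∈ T ∧ R ∈ T ∨ Q ∈ T ∧ S ∈ T ∨
      R ∈ T ∧ S ∈ T := by
  grind

theorem two_mem_of_three {β : Type*} {T : Set β} {P Q R A B : β} (hA : A ∈ T) (hB : B ∈ T)
    (hAB : A ≠ B) (hA' : A = P ∨ A = Q ∨ A = R) (hB' : B = P ∨ B = Q ∨ B = R) :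
    P ∈ T ∧ Q ∈ T ∨ P ∈ T ∧ R ∈ T ∨ Q ∈ T ∧ R ∈ T := by
  grind

theorem exists_fano_of_mem {T : Set (Finset α)} {p q r a b c d : α}
    (hd : [p, q, r, a, b, c, d].Nodup) (h1 : {p, q, r} ∈ T) (h2 : {p, a, b} ∈ T)
    (h3 : {p, c, d} ∈ T) (h4 : {q, a, c} ∈ T) (h5 : {q, b, d} ∈ T) (h6 : {r, b, c} ∈ T)
    (h7 : {r, a, d} ∈ T) : ∃ v : Fin 7 ↪ α, ∀ L ∈ fanoFin, L.map v ∈ T := by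
  refine ⟨⟨[p, q, r, a, b, c, d].get, List.nodup_iff_injective_get.mp hd⟩, ?_⟩
  intro L hL
  simp only [fanoFin, Finset.mem_insert, Finset.mem_singleton] at hL
  rcases hL with rfl | rfl | rfl | rfl | rfl | rfl | rfl <;>
    simpa only [Finset.map_insert, Finset.map_singleton, Function.Embedding.coeFn_mk]

/-- Three triples of an intersecting family with one common point and otherwise disjoint force a
Fano plane: the triples that meet `{p, q, r}` only in `q`, or only in `r`, have their other two
points in `{a, b}` and `{c, d}`, and no pair `{p, w}` meets everything. -/
theorem exists_fano_of_sunflower {T : Set (Finset α)} (hcard : ∀ A ∈ T, A.card = 3)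
    (hint : ∀ A ∈ T, ∀ B ∈ T, ∃ x, x ∈ A ∧ x ∈ B)
    (hdiv : ∀ x y : α, x ≠ y → ∃ A ∈ T, ∃ B ∈ T, A ≠ B ∧ x ∉ A ∧ y ∉ A ∧ x ∉ B ∧ y ∉ B)
    {p q r a b c d : α} (hd : [p, q, r, a, b, c, d].Nodup)
    (h1 : {p, q, r} ∈ T) (h2 : {p, a, b} ∈ T) (h3 : {p, c, d} ∈ T) :
    ∃ v : Fin 7 ↪ α, ∀ L ∈ fanoFin, L.map v ∈ T := by
  have hd0 := hd
  simp only [List.nodup_cons, List.mem_cons, List.not_mem_nil, or_false, not_or] at hd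
  obtain ⟨⟨dpq, dpr, dpa, dpb, dpc, dpd⟩, ⟨dqr, dqa, dqb, dqc, dqd⟩, ⟨dra, drb, drc, drd⟩,
    ⟨dab, dac, dad⟩, ⟨dbc, dbd⟩, dcd, -⟩ := hd
  -- a triple avoiding `p` consists of `q` or `r`, one of `a, b`, and one of `c, d`
  have shape : ∀ A ∈ T, p ∉ A → ∃ i x y, (i = q ∨ i = r) ∧ (x = a ∨ x = b) ∧ (y = c ∨ y = d) ∧
      A = {i, x, y} := by
    intro A hA hp
    obtain ⟨i, hiA, hi⟩ := hint A hA _ h1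
    obtain ⟨x, hxA, hx⟩ := hint A hA _ h2
    obtain ⟨y, hyA, hy⟩ := hint A hA _ h3
    simp only [Finset.mem_insert, Finset.mem_singleton] at hi hx hy
    have hi' : i = q ∨ i = r := hi.resolve_left (fun h => hp (h ▸ hiA))
    have hx' : x = a ∨ x = b := hx.resolve_left (fun h => hp (h ▸ hxA))
    have hy' : y = c ∨ y = d := hy.resolve_left (fun h => hp (h ▸ hyA))
    refine ⟨i, x, y, hi', hx', hy', eq_triple_of_mem (hcard A hA) hiA hxA hyA ?_ ?_ ?_⟩ <;> grind
  have cross : ∀ x y x' y', ({q, x, y} : Finset α) ∈ T → {r, x', y'} ∈ T →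
      q ≠ x' → q ≠ y' → r ≠ x → r ≠ y → x ≠ x' → x ≠ y' → y ≠ x' → y ≠ y' → False := by
    intro x y x' y' hA hB
    obtain ⟨z, hz, hz'⟩ := hint _ hA _ hB
    simp only [Finset.mem_insert, Finset.mem_singleton] at hz hz'
    grind
  have cross1 : {q, a, c} ∈ T → {r, b, d} ∉ T := fun h h' => by
    apply cross _ _ _ _ h h' <;> grind
  have cross2 : {q, a, d} ∈ T → {r, b, c} ∉ T := fun h h' => by
    apply cross _ _ _ _ h h' <;> grind
  have cross3 : {q, b, c} ∈ T → {r, a, d} ∉ T := fun h h' => by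
    apply cross _ _ _ _ h h' <;> grind
  have cross4 : {q, b, d} ∈ T → {r, a, c} ∉ T := fun h h' => by
    apply cross _ _ _ _ h h' <;> grind
  have two : ∀ i j, (i = q ∧ j = r ∨ i = r ∧ j = q) → ∃ A ∈ T, ∃ B ∈ T, A ≠ B ∧
      (A = {i, a, c} ∨ A = {i, a, d} ∨ A = {i, b, c} ∨ A = {i, b, d}) ∧
      (B = {i, a, c} ∨ B = {i, a, d} ∨ B = {i, b, c} ∨ B = {i, b, d}) := by
    intro i j hij
    obtain ⟨A, hA, B, hB, hAB, hpA, hjA, hpB, hjB⟩ := hdiv p j (by grind)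
    refine ⟨A, hA, B, hB, hAB, ?_, ?_⟩
    · obtain ⟨i', x, y, hi, hx, hy, rfl⟩ := shape A hA hpA
      have : i' = i := by simp at hjA; grind
      subst this
      rcases hx with rfl | rfl <;> rcases hy with rfl | rfl <;> simp
    · obtain ⟨i', x, y, hi, hx, hy, rfl⟩ := shape B hB hpB
      have : i' = i := by simp at hjB; grind
      subst this
      rcases hx with rfl | rfl <;> rcases hy with rfl | rfl <;> simp
  have one : ∀ w, p ≠ w → ∃ i x y, (i = q ∨ i = r) ∧ (x = a ∨ x = b) ∧
      (y = c ∨ y = d) ∧ w ≠ x ∧ w ≠ y ∧ {i, x, y} ∈ T := by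
    intro w hw
    obtain ⟨A, hA, -, -, -, hpA, hwA, -⟩ := hdiv p w hw
    obtain ⟨i, x, y, hi, hx, hy, rfl⟩ := shape A hA hpA
    simp only [Finset.mem_insert, Finset.mem_singleton, not_or] at hwA
    exact ⟨i, x, y, hi, hx, hy, hwA.2.1, hwA.2.2, hA⟩
  have offa : {q, b, c} ∈ T ∨ {q, b, d} ∈ T ∨ {r, b, c} ∈ T ∨ {r, b, d} ∈ T := by
    obtain ⟨i, x, y, rfl | rfl, rfl | rfl, rfl | rfl, hx, hy, h⟩ := one a dpa
    all_goals first
      | exact absurd rfl hx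
      | exact absurd rfl hy
      | exact Or.inl h
      | exact Or.inr (Or.inl h)
      | exact Or.inr (Or.inr (Or.inl h))
      | exact Or.inr (Or.inr (Or.inr h))
  have offb : {q, a, c} ∈ T ∨ {q, a, d} ∈ T ∨ {r, a, c} ∈ T ∨ {r, a, d} ∈ T := by
    obtain ⟨i, x, y, rfl | rfl, rfl | rfl, rfl | rfl, hx, hy, h⟩ := one b dpb
    all_goals first
      | exact absurd rfl hx
      | exact absurd rfl hy
      | exact Or.inl h
      | exact Or.inr (Or.inl h)
      | exact Or.inr (Or.inr (Or.inl h))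
      | exact Or.inr (Or.inr (Or.inr h))
  have offc : {q, a, d} ∈ T ∨ {q, b, d} ∈ T ∨ {r, a, d} ∈ T ∨ {r, b, d} ∈ T := by
    obtain ⟨i, x, y, rfl | rfl, rfl | rfl, rfl | rfl, hx, hy, h⟩ := one c dpc
    all_goals first
      | exact absurd rfl hx
      | exact absurd rfl hy
      | exact Or.inl h
      | exact Or.inr (Or.inl h)
      | exact Or.inr (Or.inr (Or.inl h))
      | exact Or.inr (Or.inr (Or.inr h))
  have offd : {q, a, c} ∈ T ∨ {q, b, c} ∈ T ∨ {r, a, c} ∈ T ∨ {r, b, c} ∈ T := by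
    obtain ⟨i, x, y, rfl | rfl, rfl | rfl, rfl | rfl, hx, hy, h⟩ := one d dpd
    all_goals first
      | exact absurd rfl hx
      | exact absurd rfl hy
      | exact Or.inl h
      | exact Or.inr (Or.inl h)
      | exact Or.inr (Or.inr (Or.inl h))
      | exact Or.inr (Or.inr (Or.inr h))
  have h3' : {p, d, c} ∈ T := by rwa [Finset.pair_comm d c]
  obtain ⟨A, hA, B, hB, hAB, hA', hB'⟩ := two q r (Or.inl ⟨rfl, rfl⟩)
  obtain ⟨C, hC, D, hD, hCD, hC', hD'⟩ := two r q (Or.inr ⟨rfl, rfl⟩)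
  have key := matchings_of_cross cross1 cross2 cross3 cross4 offa offb offc offd
    (two_mem_of_four hA hB hAB hA' hB') (two_mem_of_four hC hD hCD hC' hD')
  rcases key with ⟨k1, k2, k3, k4⟩ | ⟨k1, k2, k3, k4⟩
  · exact exists_fano_of_mem hd0 h1 h2 h3 k1 k2 k3 k4
  · refine exists_fano_of_mem ?_ h1 h2 h3' k1 k2 k3 k4
    simp only [List.nodup_cons, List.mem_cons, List.not_mem_nil, or_false, not_or]
    exact ⟨⟨dpq, dpr, dpa, dpb, dpd, dpc⟩, ⟨dqr, dqa, dqb, dqd, dqc⟩, ⟨dra, drb, drd, drc⟩,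
      ⟨dab, dad, dac⟩, ⟨dbd, dbc⟩, Ne.symm dcd, not_false, List.nodup_nil⟩

/-- If the triples that meet `{p, q, r}` in one point all contain `a` or `b`, then a triple that
avoids `a` and `b` has two points in `{p, q, r}`; its third point is `c`. -/
theorem mem_of_avoiding_pair {T : Set (Finset α)} (hcard : ∀ A ∈ T, A.card = 3)
    (hint : ∀ A ∈ T, ∀ B ∈ T, ∃ x, x ∈ A ∧ x ∈ B)
    (hdiv : ∀ x y : α, x ≠ y → ∃ A ∈ T, ∃ B ∈ T, A ≠ B ∧ x ∉ A ∧ y ∉ A ∧ x ∉ B ∧ y ∉ B)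
    {p q r a b c : α} (hpq : p ≠ q) (hpr : p ≠ r) (hqr : q ≠ r) (hab : a ≠ b)
    (hc : c ∉ ({p, q, r} : Finset α)) (hP : {p, q, r} ∈ T)
    (hE : ∀ A ∈ T, ∀ i ∈ ({p, q, r} : Finset α), i ∈ A →
      (∀ z ∈ ({p, q, r} : Finset α), z ∈ A → z = i) → a ∈ A ∨ b ∈ A)
    (hk : ∀ k ∈ ({p, q, r} : Finset α), {k, b, c} ∈ T ∨ {k, a, c} ∈ T) :
    {q, r, c} ∈ T ∨ {p, r, c} ∈ T ∨ {p, q, c} ∈ T := by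
  obtain ⟨C, hC, hCP, haC, hbC⟩ : ∃ C ∈ T, C ≠ {p, q, r} ∧ a ∉ C ∧ b ∉ C := by
    obtain ⟨A, hA, B, hB, hAB, h1, h2, h3, h4⟩ := hdiv a b hab
    by_cases h : A = {p, q, r}
    · exact ⟨B, hB, fun h' => hAB (h.trans h'.symm), h3, h4⟩
    · exact ⟨A, hA, h, h1, h2⟩
  simp only [Finset.mem_insert, Finset.mem_singleton, not_or] at hc
  have fin : ∀ i j k, i ≠ j → i ≠ k → j ≠ k → i ∈ C → j ∈ C → ({p, q, r} : Finset α) = {i, j, k} →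
      c ≠ i → c ≠ j → {i, j, c} ∈ T := by
    intro i j k hij hik hjk hi hj hP' hci hcj
    have hkC : k ∉ C := fun hkC =>
      hCP ((eq_triple_of_mem (hcard C hC) hi hj hkC hij hik hjk).trans hP'.symm)
    have hcC : c ∈ C := by
      rcases hk k (by simp [hP']) with h | h
      all_goals
        obtain ⟨z, hz, hz'⟩ := hint C hC _ h
        simp only [Finset.mem_insert, Finset.mem_singleton] at hz'
        rcases hz' with rfl | rfl | rfl
        · exact absurd hz hkC
        · first
          | exact absurd hz hbC
          | exact absurd hz haC
        · exact hz
    rwa [← eq_triple_of_mem (hcard C hC) hi hj hcC hij hci.symm hcj.symm]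
  by_cases h1 : p ∈ C
  · by_cases h2 : q ∈ C
    · exact Or.inr (Or.inr (fin p q r hpq hpr hqr h1 h2 rfl hc.1 hc.2.1))
    · by_cases h3 : r ∈ C
      · exact Or.inr (Or.inl (fin p r q hpr hpq hqr.symm h1 h3 (by rw [Finset.pair_comm])
          hc.1 hc.2.2))
      · have := hE C hC p (by simp) h1 (by simp [h2, h3])
        tauto
  · by_cases h2 : q ∈ C
    · by_cases h3 : r ∈ C
      · exact Or.inl (fin q r p hqr hpq.symm hpr.symm h2 h3
          ((insert_pair_rotate q r p).symm) hc.2.1 hc.2.2)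
      · have := hE C hC q (by simp) h2 (by simp [h1, h3])
        tauto
    · by_cases h3 : r ∈ C
      · have := hE C hC r (by simp) h3 (by simp [h1, h2])
        tauto
      · obtain ⟨z, hz, hz'⟩ := hint C hC _ hP
        simp only [Finset.mem_insert, Finset.mem_singleton] at hz'
        rcases hz' with rfl | rfl | rfl <;> contradiction

/-- `E i x` says that the edge of the triangle `{a, b, c}` opposite `x` forms a triple with `i`,
and `F i x` that `x` forms a triple with the two points of `{p, q, r}` other than `i`. Then each of
`p`, `q`, `r` misses exactly one edge, and the opposite points form a permutation of `a, b, c`. -/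
theorem exists_matching_of_opposite {Epa Epb Epc Eqa Eqb Eqc Era Erb Erc
    Fpa Fpb Fpc Fqa Fqb Fqc Fra Frb Frc : Prop}
    (hp : Epc ∧ Epb ∨ Epc ∧ Epa ∨ Epb ∧ Epa) (hq : Eqc ∧ Eqb ∨ Eqc ∧ Eqa ∨ Eqb ∧ Eqa)
    (hr : Erc ∧ Erb ∨ Erc ∧ Era ∨ Erb ∧ Era)
    (npa : Fpa → ¬ Epa) (npb : Fpb → ¬ Epb) (npc : Fpc → ¬ Epc)
    (nqa : Fqa → ¬ Eqa) (nqb : Fqb → ¬ Eqb) (nqc : Fqc → ¬ Eqc)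
    (nra : Fra → ¬ Era) (nrb : Frb → ¬ Erb) (nrc : Frc → ¬ Erc)
    (fa : Fpa ∨ Fqa ∨ Fra) (fb : Fpb ∨ Fqb ∨ Frb) (fc : Fpc ∨ Fqc ∨ Frc) :
    (Fpa ∧ Fqb ∧ Frc ∧ (Epb ∧ Epc) ∧ (Eqa ∧ Eqc) ∧ (Era ∧ Erb)) ∨
    (Fpa ∧ Frb ∧ Fqc ∧ (Epb ∧ Epc) ∧ (Era ∧ Erc) ∧ (Eqa ∧ Eqb)) ∨
    (Fqa ∧ Fpb ∧ Frc ∧ (Eqb ∧ Eqc) ∧ (Epa ∧ Epc) ∧ (Era ∧ Erb)) ∨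
    (Fqa ∧ Frb ∧ Fpc ∧ (Eqb ∧ Eqc) ∧ (Era ∧ Erc) ∧ (Epa ∧ Epb)) ∨
    (Fra ∧ Fpb ∧ Fqc ∧ (Erb ∧ Erc) ∧ (Epa ∧ Epc) ∧ (Eqa ∧ Eqb)) ∨
    (Fra ∧ Fqb ∧ Fpc ∧ (Erb ∧ Erc) ∧ (Eqa ∧ Eqc) ∧ (Epa ∧ Epb)) := by
  rcases fa with h1 | h1 | h1 <;> rcases fb with h2 | h2 | h2 <;> rcases fc with h3 | h3 | h3 <;>
    grind (splits := 20)

/-- Without sunflowers, the pairs extending a point of the triple `P` form an intersecting graph: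
a triple `A` that meets `P` only in `i` contains `x` or `y` whenever `{l, x, y}` meets `P` only
in `l`. -/
theorem mem_or_mem_of_no_sunflower {T : Set (Finset α)}
    (hint : ∀ A ∈ T, ∀ B ∈ T, ∃ x, x ∈ A ∧ x ∈ B)
    (hns : ∀ A ∈ T, ∀ B ∈ T, ∀ C ∈ T, ∀ x, x ∈ A → x ∈ B → x ∈ C →
      ∃ y, y ≠ x ∧ (y ∈ A ∧ y ∈ B ∨ y ∈ A ∧ y ∈ C ∨ y ∈ B ∧ y ∈ C))
    {P A : Finset α} {i l x y : α} (hP : P ∈ T) (hA : A ∈ T) (hiA : i ∈ A)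
    (hAi : ∀ z ∈ P, z ∈ A → z = i) (hl : l ∈ P) (hx : x ∉ P) (hy : y ∉ P) (h : {l, x, y} ∈ T) :
    x ∈ A ∨ y ∈ A := by
  by_cases hli : l = i
  · subst hli
    obtain ⟨z, hzl, hz⟩ := hns _ hP A hA _ h l hl hiA (by simp)
    simp only [Finset.mem_insert, Finset.mem_singleton] at hz
    rcases hz with ⟨hz, hzA⟩ | ⟨hz, rfl | rfl | rfl⟩ | ⟨hzA, rfl | rfl | rfl⟩
    · exact absurd (hAi z hz hzA) hzl
    · exact absurd rfl hzl
    · exact absurd hz hx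
    · exact absurd hz hy
    · exact absurd rfl hzl
    · exact Or.inl hzA
    · exact Or.inr hzA
  · obtain ⟨z, hzA, hz⟩ := hint A hA _ h
    simp only [Finset.mem_insert, Finset.mem_singleton] at hz
    rcases hz with rfl | rfl | rfl
    · exact absurd (hAi z hl hzA) hli
    · exact Or.inl hzA
    · exact Or.inr hzA

theorem exists_design_of_mem {T : Set (Finset α)} {k₀ k₁ k₂ a b c : α}
    (hd : [k₀, k₁, k₂, a, b, c].Nodup)
    (h1 : {k₀, k₁, k₂} ∈ T) (h2 : {k₀, k₁, a} ∈ T) (h3 : {k₀, k₂, b} ∈ T) (h4 : {k₁, k₂, c} ∈ T)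
    (h5 : {k₂, a, b} ∈ T) (h6 : {k₂, a, c} ∈ T) (h7 : {k₁, a, b} ∈ T) (h8 : {k₁, b, c} ∈ T)
    (h9 : {k₀, a, c} ∈ T) (h10 : {k₀, b, c} ∈ T) :
    ∃ v : Fin 6 ↪ α, ∀ L ∈ designFin, L.map v ∈ T := by
  refine ⟨⟨[k₀, k₁, k₂, a, b, c].get, List.nodup_iff_injective_get.mp hd⟩, ?_⟩
  intro L hL
  simp only [designFin, Finset.mem_insert, Finset.mem_singleton] at hL
  rcases hL with rfl | rfl | rfl | rfl | rfl | rfl | rfl | rfl | rfl | rfl <;>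
    simpa only [Finset.map_insert, Finset.map_singleton, Function.Embedding.coeFn_mk]

theorem triple_notMem_of_disjoint {T : Set (Finset α)}
    (hint : ∀ A ∈ T, ∀ B ∈ T, ∃ x, x ∈ A ∧ x ∈ B) {i j x k y z : α} (h1 : {i, j, x} ∈ T)
    (n1 : i ≠ k) (n2 : i ≠ y) (n3 : i ≠ z) (n4 : j ≠ k) (n5 : j ≠ y) (n6 : j ≠ z)
    (n7 : x ≠ k) (n8 : x ≠ y) (n9 : x ≠ z) : {k, y, z} ∉ T := by
  intro h2
  obtain ⟨w, hw, hw'⟩ := hint _ h1 _ h2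
  simp only [Finset.mem_insert, Finset.mem_singleton] at hw hw'
  clear h1 h2 hint
  rcases hw with rfl | rfl | rfl <;> tauto

/-- The ten triples of the design, once each of `p`, `q`, `r` goes with two edges of the triangle
`{a, b, c}` and each of `a`, `b`, `c` goes with two of `p`, `q`, `r`. -/
theorem exists_design_of_triangle {T : Set (Finset α)}
    (hint : ∀ A ∈ T, ∀ B ∈ T, ∃ x, x ∈ A ∧ x ∈ B)
    {p q r a b c : α} (hpq : p ≠ q) (hpr : p ≠ r) (hqr : q ≠ r) (hab : a ≠ b) (hac : a ≠ c)
    (hbc : b ≠ c) (haP : a ∉ ({p, q, r} : Finset α)) (hbP : b ∉ ({p, q, r} : Finset α))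
    (hcP : c ∉ ({p, q, r} : Finset α)) (hP : {p, q, r} ∈ T)
    (hp : {p, a, b} ∈ T ∧ {p, a, c} ∈ T ∨ {p, a, b} ∈ T ∧ {p, b, c} ∈ T ∨
      {p, a, c} ∈ T ∧ {p, b, c} ∈ T)
    (hq : {q, a, b} ∈ T ∧ {q, a, c} ∈ T ∨ {q, a, b} ∈ T ∧ {q, b, c} ∈ T ∨
      {q, a, c} ∈ T ∧ {q, b, c} ∈ T)
    (hr : {r, a, b} ∈ T ∧ {r, a, c} ∈ T ∨ {r, a, b} ∈ T ∧ {r, b, c} ∈ T ∨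
      {r, a, c} ∈ T ∧ {r, b, c} ∈ T)
    (fa : {q, r, a} ∈ T ∨ {p, r, a} ∈ T ∨ {p, q, a} ∈ T)
    (fb : {q, r, b} ∈ T ∨ {p, r, b} ∈ T ∨ {p, q, b} ∈ T)
    (fc : {q, r, c} ∈ T ∨ {p, r, c} ∈ T ∨ {p, q, c} ∈ T) :
    ∃ v : Fin 6 ↪ α, ∀ L ∈ designFin, L.map v ∈ T := by
  simp only [Finset.mem_insert, Finset.mem_singleton, not_or] at haP hbP hcP
  obtain ⟨hap, haq, har⟩ := haP
  obtain ⟨hbp, hbq, hbr⟩ := hbP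
  obtain ⟨hcp, hcq, hcr⟩ := hcP
  have swap : ∀ {x y z : α}, ({x, y, z} : Finset α) ∈ T → {y, x, z} ∈ T := fun h => by
    rwa [Finset.insert_comm]
  have rot : ∀ {x y z : α}, ({x, y, z} : Finset α) ∈ T → {x, z, y} ∈ T := fun h => by
    rwa [Finset.pair_comm]
  have off : ∀ i, (i = p ∨ i = q ∨ i = r) → i ≠ a ∧ i ≠ b ∧ i ≠ c := by
    rintro i (rfl | rfl | rfl)
    · exact ⟨Ne.symm hap, Ne.symm hbp, Ne.symm hcp⟩
    · exact ⟨Ne.symm haq, Ne.symm hbq, Ne.symm hcq⟩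
    · exact ⟨Ne.symm har, Ne.symm hbr, Ne.symm hcr⟩
  have hp' : p = p ∨ p = q ∨ p = r := Or.inl rfl
  have hq' : q = p ∨ q = q ∨ q = r := Or.inr (Or.inl rfl)
  have hr' : r = p ∨ r = q ∨ r = r := Or.inr (Or.inr rfl)
  have nodup : ∀ i j k, i ≠ j → i ≠ k → j ≠ k → (i = p ∨ i = q ∨ i = r) → (j = p ∨ j = q ∨ j = r) →
      (k = p ∨ k = q ∨ k = r) → [i, j, k, a, b, c].Nodup := by
    intro i j k hij hik hjk hi hj hk
    simp only [List.nodup_cons, List.mem_cons, List.not_mem_nil, or_false, not_or]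
    exact ⟨⟨hij, hik, off i hi⟩, ⟨hjk, off j hj⟩, off k hk, ⟨hab, hac⟩, hbc, not_false,
      List.nodup_nil⟩
  have hqp := hpq.symm
  have hrp := hpr.symm
  have hrq := hqr.symm
  have hopp : ∀ i j k, i ≠ k → j ≠ k → (i = p ∨ i = q ∨ i = r) → (j = p ∨ j = q ∨ j = r) →
      (k = p ∨ k = q ∨ k = r) → ({i, j, a} ∈ T → {k, b, c} ∉ T) ∧ ({i, j, b} ∈ T → {k, a, c} ∉ T) ∧
      ({i, j, c} ∈ T → {k, a, b} ∉ T) := by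
    intro i j k hik hjk hi hj hk
    obtain ⟨ia, ib, ic⟩ := off i hi
    obtain ⟨ja, jb, jc⟩ := off j hj
    obtain ⟨ka, kb, kc⟩ := off k hk
    exact ⟨fun h => triple_notMem_of_disjoint hint h hik ib ic hjk jb jc ka.symm hab hac,
      fun h => triple_notMem_of_disjoint hint h hik ia ic hjk ja jc kb.symm hab.symm hbc,
      fun h => triple_notMem_of_disjoint hint h hik ia ib hjk ja jb kc.symm hac.symm hbc.symm⟩
  obtain ⟨n1, n2, n3⟩ := hopp q r p hqp hrp hq' hr' hp'
  obtain ⟨n4, n5, n6⟩ := hopp p r q hpq hrq hp' hr' hq'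
  obtain ⟨n7, n8, n9⟩ := hopp p q r hpr hqr hp' hq' hr'
  rcases exists_matching_of_opposite hp hq hr n1 n2 n3 n4 n5 n6 n7 n8 n9 fa fb fc with
    ⟨f1, f2, f3, ⟨e1, e2⟩, ⟨e3, e4⟩, e5, e6⟩ | ⟨f1, f2, f3, ⟨e1, e2⟩, ⟨e3, e4⟩, e5, e6⟩ |
    ⟨f1, f2, f3, ⟨e1, e2⟩, ⟨e3, e4⟩, e5, e6⟩ | ⟨f1, f2, f3, ⟨e1, e2⟩, ⟨e3, e4⟩, e5, e6⟩ |
    ⟨f1, f2, f3, ⟨e1, e2⟩, ⟨e3, e4⟩, e5, e6⟩ | ⟨f1, f2, f3, ⟨e1, e2⟩, ⟨e3, e4⟩, e5, e6⟩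
  · exact exists_design_of_mem (nodup _ _ _ hrq hrp hqp hr' hq' hp') (rot (swap (rot hP)))
      (swap f1) (swap f2) (swap f3) e2 e1 e4 e3 e6 e5
  · exact exists_design_of_mem (nodup _ _ _ hqr hqp hrp hq' hr' hp') (rot (swap hP))
      f1 (swap f2) (swap f3) e2 e1 e4 e3 e6 e5
  · exact exists_design_of_mem (nodup _ _ _ hrp hrq hpq hr' hp' hq') (swap (rot hP))
      (swap f1) (swap f2) f3 e2 e1 e4 e3 e6 e5
  · exact exists_design_of_mem (nodup _ _ _ hpr hpq hrq hp' hr' hq') (rot hP)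
      f1 f2 (swap f3) e2 e1 e4 e3 e6 e5
  · exact exists_design_of_mem (nodup _ _ _ hqp hqr hpr hq' hp' hr') (swap hP)
      (swap f1) f2 f3 e2 e1 e4 e3 e6 e5
  · exact exists_design_of_mem (nodup _ _ _ hpq hpr hqr hp' hq' hr') hP
      f1 f2 f3 e2 e1 e4 e3 e6 e5

/-- Without a sunflower of three triples with a common point, the pairs that extend a point of a
fixed triple `{p, q, r}` form an intersecting graph, which is the triangle `{a, b, c}`: a star
with centre `a` would leave no triple to avoid a suitable pair. Each of `p`, `q`, `r` then goes
with exactly two edges of the triangle, and the missing edges differ. -/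
theorem exists_design_of_no_sunflower {T : Set (Finset α)} (hcard : ∀ A ∈ T, A.card = 3)
    (hint : ∀ A ∈ T, ∀ B ∈ T, ∃ x, x ∈ A ∧ x ∈ B)
    (hdiv : ∀ x y : α, x ≠ y → ∃ A ∈ T, ∃ B ∈ T, A ≠ B ∧ x ∉ A ∧ y ∉ A ∧ x ∉ B ∧ y ∉ B)
    (hns : ∀ A ∈ T, ∀ B ∈ T, ∀ C ∈ T, ∀ x, x ∈ A → x ∈ B → x ∈ C →
      ∃ y, y ≠ x ∧ (y ∈ A ∧ y ∈ B ∨ y ∈ A ∧ y ∈ C ∨ y ∈ B ∧ y ∈ C))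
    (hne : T.Nonempty) :
    ∃ v : Fin 6 ↪ α, ∀ L ∈ designFin, L.map v ∈ T := by
  obtain ⟨P, hP⟩ := hne
  obtain ⟨p, q, r, hpq, hpr, hqr, rfl⟩ := Finset.card_eq_three.mp (hcard P hP)
  have meet : ∀ A ∈ T, ∀ i ∈ ({p, q, r} : Finset α), i ∈ A →
      (∀ z ∈ ({p, q, r} : Finset α), z ∈ A → z = i) → ∀ l ∈ ({p, q, r} : Finset α),
      ∀ x y, x ∉ ({p, q, r} : Finset α) → y ∉ ({p, q, r} : Finset α) → {l, x, y} ∈ T →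
      x ∈ A ∨ y ∈ A := fun A hA i _ hiA hAi l hl x y hx hy h =>
    mem_or_mem_of_no_sunflower hint hns hP hA hiA hAi hl hx hy h
  -- two edges of the graph at the point `r`
  obtain ⟨a, b, c, hab, hac, hbc, haP, hbP, hcP, hrab, hrac⟩ : ∃ a b c, a ≠ b ∧ a ≠ c ∧ b ≠ c ∧
      a ∉ ({p, q, r} : Finset α) ∧ b ∉ ({p, q, r} : Finset α) ∧ c ∉ ({p, q, r} : Finset α) ∧
      {r, a, b} ∈ T ∧ {r, a, c} ∈ T := by
    obtain ⟨A, hA, B, hB, hAB, hpA, hqA, hpB, hqB⟩ := hdiv p q hpq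
    have hr : ∀ A ∈ T, p ∉ A → q ∉ A → r ∈ A := by
      intro A hA hp hq
      obtain ⟨z, hz, hz'⟩ := hint A hA _ hP
      simp only [Finset.mem_insert, Finset.mem_singleton] at hz'
      rcases hz' with rfl | rfl | rfl
      · exact absurd hz hp
      · exact absurd hz hq
      · exact hz
    have hrB := hr B hB hpB hqB
    obtain ⟨x, y, hrx, hry, hxy, rfl⟩ := exists_eq_triple_of_mem (hcard A hA) (hr A hA hpA hqA)
    simp only [Finset.mem_insert, Finset.mem_singleton, not_or] at hpA hqA
    have hxP : x ∉ ({p, q, r} : Finset α) := by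
      simp only [Finset.mem_insert, Finset.mem_singleton, not_or]
      exact ⟨Ne.symm hpA.2.1, Ne.symm hqA.2.1, hrx.symm⟩
    have hyP : y ∉ ({p, q, r} : Finset α) := by
      simp only [Finset.mem_insert, Finset.mem_singleton, not_or]
      exact ⟨Ne.symm hpA.2.2, Ne.symm hqA.2.2, hry.symm⟩
    have third : ∀ a b, r ≠ a → a ∈ B → a ≠ b → B ≠ {r, a, b} →
        ∃ c, a ≠ c ∧ b ≠ c ∧ c ∉ ({p, q, r} : Finset α) ∧ {r, a, c} ∈ T := by
      intro a b hra haB hab hne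
      obtain ⟨u, w, hru, hrw, huw, rfl⟩ := exists_eq_triple_of_mem (hcard B hB) hrB
      simp only [Finset.mem_insert, Finset.mem_singleton, not_or] at haB hpB hqB ⊢
      rcases haB with rfl | rfl | rfl
      · exact absurd rfl hra
      · exact ⟨w, huw, fun h => hne (by rw [h]), ⟨Ne.symm hpB.2.2, Ne.symm hqB.2.2, hrw.symm⟩, hB⟩
      · exact ⟨u, huw.symm, fun h => hne (by rw [h, Finset.pair_comm]),
          ⟨Ne.symm hpB.2.1, Ne.symm hqB.2.1, hru.symm⟩, by rwa [Finset.pair_comm]⟩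
    have hBr : ∀ z ∈ ({p, q, r} : Finset α), z ∈ B → z = r := by
      intro z hz hzB
      simp only [Finset.mem_insert, Finset.mem_singleton] at hz
      rcases hz with rfl | rfl | rfl
      · exact absurd hzB hpB
      · exact absurd hzB hqB
      · rfl
    rcases meet B hB r (by simp) hrB hBr r (by simp) x y hxP hyP hA with h | h
    · obtain ⟨c, h1, h2, h3, h4⟩ := third x y hrx h hxy hAB.symm
      exact ⟨x, y, c, hxy, h1, h2, hxP, hyP, h3, hA, h4⟩
    · rw [Finset.pair_comm] at hA hAB
      obtain ⟨c, h1, h2, h3, h4⟩ := third y x hry h hxy.symm hAB.symm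
      exact ⟨y, x, c, hxy.symm, h1, h2, hyP, hxP, h3, hA, h4⟩
  -- a triple avoiding `a` and `r` supplies the third edge, so the graph is not a star
  obtain ⟨i, hiP, hibc⟩ : ∃ i ∈ ({p, q, r} : Finset α), {i, b, c} ∈ T := by
    have har : a ≠ r := fun h => haP (by simp [h])
    obtain ⟨C, hC, -, -, -, haC, hrC, -⟩ := hdiv a r har
    have other : ∀ x, {r, a, x} ∈ T → x ∈ C := by
      intro x hx
      obtain ⟨z, hzC, hz⟩ := hint C hC _ hx
      simp only [Finset.mem_insert, Finset.mem_singleton] at hz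
      rcases hz with rfl | rfl | rfl
      · exact absurd hzC hrC
      · exact absurd hzC haC
      · exact hzC
    obtain ⟨i, hiC, hi⟩ := hint C hC _ hP
    refine ⟨i, hi, ?_⟩
    rwa [← eq_triple_of_mem (hcard C hC) hiC (other b hrab) (other c hrac)
      (fun h => hbP (h ▸ hi)) (fun h => hcP (h ▸ hi)) hbc]
  have hr : r ∈ ({p, q, r} : Finset α) := by simp
  have edge : ∀ A ∈ T, ∀ i ∈ ({p, q, r} : Finset α), i ∈ A →
      (∀ z ∈ ({p, q, r} : Finset α), z ∈ A → z = i) →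
      (a ∈ A ∨ b ∈ A) ∧ (a ∈ A ∨ c ∈ A) ∧ (b ∈ A ∨ c ∈ A) := fun A hA j hj hjA hAj =>
    ⟨meet A hA j hj hjA hAj r hr a b haP hbP hrab, meet A hA j hj hjA hAj r hr a c haP hcP hrac,
      meet A hA j hj hjA hAj i hiP b c hbP hcP hibc⟩
  have two : ∀ i j k, ({p, q, r} : Finset α) = {i, j, k} → j ≠ k →
      {i, a, b} ∈ T ∧ {i, a, c} ∈ T ∨ {i, a, b} ∈ T ∧ {i, b, c} ∈ T ∨
        {i, a, c} ∈ T ∧ {i, b, c} ∈ T := by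
    intro i j k hijk hjk
    have hi : i ∈ ({p, q, r} : Finset α) := by simp [hijk]
    have hia : i ≠ a := fun h => haP (h ▸ hi)
    have hib : i ≠ b := fun h => hbP (h ▸ hi)
    have hic : i ≠ c := fun h => hcP (h ▸ hi)
    have shape : ∀ A ∈ T, j ∉ A → k ∉ A → A = {i, a, b} ∨ A = {i, a, c} ∨ A = {i, b, c} := by
      intro A hA hj hk
      have only : ∀ z ∈ ({p, q, r} : Finset α), z ∈ A → z = i := by
        intro z hz hzA
        rw [hijk] at hz
        simp only [Finset.mem_insert, Finset.mem_singleton] at hz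
        rcases hz with rfl | rfl | rfl
        · rfl
        · exact absurd hzA hj
        · exact absurd hzA hk
      obtain ⟨z, hzA, hz⟩ := hint A hA _ hP
      have hiA : i ∈ A := only z hz hzA ▸ hzA
      obtain ⟨h1, h2, h3⟩ := edge A hA i hi hiA only
      by_cases ha : a ∈ A
      · rcases h3 with hb | hc
        · exact Or.inl (eq_triple_of_mem (hcard A hA) hiA ha hb hia hib hab)
        · exact Or.inr (Or.inl (eq_triple_of_mem (hcard A hA) hiA ha hc hia hic hac))
      · exact Or.inr (Or.inr (eq_triple_of_mem (hcard A hA) hiA (h1.resolve_left ha)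
          (h2.resolve_left ha) hib hic hbc))
    obtain ⟨A, hA, B, hB, hAB, h1, h2, h3, h4⟩ := hdiv j k hjk
    exact two_mem_of_three hA hB hAB (shape A hA h1 h2) (shape B hB h3 h4)
  have hp2 := two p q r rfl hqr
  have hq2 := two q p r (by rw [Finset.insert_comm]) hpr
  have hr2 := two r p q
    (insert_pair_rotate p q r) hpq
  have hall : ∀ k ∈ ({p, q, r} : Finset α), {k, a, b} ∈ T ∧ {k, a, c} ∈ T ∨
      {k, a, b} ∈ T ∧ {k, b, c} ∈ T ∨ {k, a, c} ∈ T ∧ {k, b, c} ∈ T := by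
    intro k hk
    simp only [Finset.mem_insert, Finset.mem_singleton] at hk
    rcases hk with rfl | rfl | rfl <;> assumption
  have fc := mem_of_avoiding_pair (c := c) hcard hint hdiv hpq hpr hqr hab hcP hP
    (fun A hA i hi h h' => (edge A hA i hi h h').1) fun k hk =>
      (hall k hk).elim (fun h => Or.inr h.2) (Or.elim · (fun h => Or.inl h.2) fun h => Or.inl h.2)
  have fb := mem_of_avoiding_pair (c := b) hcard hint hdiv hpq hpr hqr hac hbP hP
    (fun A hA i hi h h' => (edge A hA i hi h h').2.1) fun k hk => by
      rw [Finset.pair_comm c b]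
      exact (hall k hk).elim (fun h => Or.inr h.1)
        (Or.elim · (fun h => Or.inl h.2) fun h => Or.inl h.2)
  have fa := mem_of_avoiding_pair (c := a) hcard hint hdiv hpq hpr hqr hbc haP hP
    (fun A hA i hi h h' => (edge A hA i hi h h').2.2) fun k hk => by
      rw [Finset.pair_comm c a, Finset.pair_comm b a]
      exact (hall k hk).elim (fun h => Or.inr h.1)
        (Or.elim · (fun h => Or.inr h.1) fun h => Or.inl h.1)
  exact exists_design_of_triangle hint hpq hpr hqr hab hac hbc haP hbP hcP hP hp2 hq2 hr2 fa fb fc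

/-- An intersecting family of triples in which every pair of points is avoided by at least two
members contains a Fano plane or the ten triples of the design. -/
theorem exists_fano_or_design {T : Set (Finset α)} (hcard : ∀ A ∈ T, A.card = 3)
    (hint : ∀ A ∈ T, ∀ B ∈ T, ∃ x, x ∈ A ∧ x ∈ B)
    (hdiv : ∀ x y : α, x ≠ y → ∃ A ∈ T, ∃ B ∈ T, A ≠ B ∧ x ∉ A ∧ y ∉ A ∧ x ∉ B ∧ y ∉ B)
    (hne : T.Nonempty) :
    (∃ v : Fin 7 ↪ α, ∀ L ∈ fanoFin, L.map v ∈ T) ∨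
      ∃ v : Fin 6 ↪ α, ∀ L ∈ designFin, L.map v ∈ T := by
  by_cases hns : ∀ A ∈ T, ∀ B ∈ T, ∀ C ∈ T, ∀ x, x ∈ A → x ∈ B → x ∈ C →
      ∃ y, y ≠ x ∧ (y ∈ A ∧ y ∈ B ∨ y ∈ A ∧ y ∈ C ∨ y ∈ B ∧ y ∈ C)
  · exact Or.inr (exists_design_of_no_sunflower hcard hint hdiv hns hne)
  · left
    push Not at hns
    obtain ⟨A, hA, B, hB, C, hC, p, hpA, hpB, hpC, hdis⟩ := hns
    obtain ⟨q, r, hpq, hpr, hqr, rfl⟩ := exists_eq_triple_of_mem (hcard A hA) hpA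
    obtain ⟨a, b, hpa, hpb, hab, rfl⟩ := exists_eq_triple_of_mem (hcard B hB) hpB
    obtain ⟨c, d, hpc, hpd, hcd, rfl⟩ := exists_eq_triple_of_mem (hcard C hC) hpC
    refine exists_fano_of_sunflower hcard hint hdiv ?_ hA hB hC
    simp only [Finset.mem_insert, Finset.mem_singleton] at hdis
    simp only [List.nodup_cons, List.mem_cons, List.not_mem_nil, or_false, not_or]
    have h2 := hdis q hpq.symm
    have h3 := hdis r hpr.symm
    have h4 := hdis a hpa.symm
    have h5 := hdis b hpb.symm
    grind

end Triples

/-! ### Families generated by an embedded configuration -/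

/-- All `k`-subsets of `[n]` that contain the image under `v` of a member of `E`. -/
def familyAbove {n m : ℕ} (k : ℕ) (v : Fin m ↪ Fin n) (E : Finset (Finset (Fin m))) :
    Finset (Finset (Fin n)) :=
  (Finset.powersetCard k Finset.univ).filter (fun A => ∃ L ∈ E, L.map v ⊆ A)

theorem mem_familyAbove {n m k : ℕ} {v : Fin m ↪ Fin n} {E : Finset (Finset (Fin m))}
    {A : Finset (Fin n)} : A ∈ familyAbove k v E ↔ A.card = k ∧ ∃ L ∈ E, L.map v ⊆ A := by
  simp [familyAbove, Finset.mem_powersetCard]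

theorem generatedFamily_image_val {n m k : ℕ} (h : m ≤ n) (E : Finset (Finset (Fin m))) :
    generatedFamily n k (E.image fun L => L.image Fin.val) =
      familyAbove k (Fin.castLEEmb h) E := by
  ext A
  rw [mem_familyAbove]
  simp only [generatedFamily, Finset.mem_filter, Finset.mem_powersetCard, Finset.subset_univ,
    true_and, Finset.exists_mem_image]
  refine and_congr_right fun _ => exists_congr fun L => and_congr_right fun _ => ?_
  simp only [Finset.subset_iff, Finset.mem_map, Finset.mem_image,
    forall_exists_index, and_imp, forall_apply_eq_imp_iff₂]
  refine forall_congr' fun x => imp_congr_right fun _ => ⟨?_, fun h' => ⟨_, h', rfl⟩⟩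
  rintro ⟨y, hy, hyx⟩
  have : Fin.castLEEmb h x = y := Fin.ext hyx.symm
  rwa [this]

theorem image_familyAbove {n m k : ℕ} (v : Fin m ↪ Fin n) (E : Finset (Finset (Fin m)))
    (σ : Equiv.Perm (Fin n)) :
    (familyAbove k v E).image (fun A => A.image σ) =
      familyAbove k (v.trans σ.toEmbedding) E := by
  have sub : ∀ (v : Fin m ↪ Fin n) (σ : Equiv.Perm (Fin n)) A, A ∈ familyAbove k v E →
      A.image σ ∈ familyAbove k (v.trans σ.toEmbedding) E := by
    intro v σ A hA
    rw [mem_familyAbove] at hA ⊢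
    obtain ⟨hk, L, hL, hLA⟩ := hA
    refine ⟨by rw [Finset.card_image_of_injective _ σ.injective, hk], L, hL, ?_⟩
    rw [← Finset.map_map, Finset.map_eq_image σ.toEmbedding]
    exact Finset.image_subset_image hLA
  ext A
  rw [Finset.mem_image]
  constructor
  · rintro ⟨B, hB, rfl⟩
    exact sub v σ B hB
  · intro hA
    refine ⟨A.image σ.symm, ?_, ?_⟩
    · convert sub _ σ.symm A hA using 2
      ext x; simp
    · rw [Finset.image_image]
      simp

theorem exists_perm_trans_eq {n m : ℕ} (v w : Fin m ↪ Fin n) :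
    ∃ σ : Equiv.Perm (Fin n), v.trans σ.toEmbedding = w := by
  have := Equiv.Perm.isMultiplyPretransitive (Fin n) m
  obtain ⟨σ, hσ⟩ := this.exists_smul_eq v w
  refine ⟨σ, ?_⟩
  rw [← hσ]
  ext x
  simp

theorem familyIso_generatedFamily_iff {n m k : ℕ} (h : m ≤ n) (E : Finset (Finset (Fin m)))
    (F : Finset (Finset (Fin n))) :
    FamilyIso F (generatedFamily n k (E.image fun L => L.image Fin.val)) ↔
      ∃ v : Fin m ↪ Fin n, F = familyAbove k v E := by
  rw [generatedFamily_image_val h]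
  constructor
  · rintro ⟨σ, hσ⟩
    refine ⟨(Fin.castLEEmb h).trans σ.symm.toEmbedding, ?_⟩
    rw [← image_familyAbove, ← hσ, Finset.image_image]
    conv_lhs => rw [← Finset.image_id (s := F)]
    congr 1
    ext A : 1
    simp [Finset.image_image]
  · rintro ⟨v, rfl⟩
    obtain ⟨σ, hσ⟩ := exists_perm_trans_eq v (Fin.castLEEmb h)
    exact ⟨σ, by rw [image_familyAbove, hσ]⟩

theorem map_subset_iff_subset_filter {n m : ℕ} (v : Fin m ↪ Fin n) (L : Finset (Fin m))
    (A : Finset (Fin n)) : L.map v ⊆ A ↔ L ⊆ Finset.univ.filter (fun i => v i ∈ A) := by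
  simp [Finset.subset_iff]

theorem disjoint_map_iff_disjoint_filter {n m : ℕ} (v : Fin m ↪ Fin n) (L : Finset (Fin m))
    (A : Finset (Fin n)) :
    Disjoint (L.map v) A ↔ Disjoint L (Finset.univ.filter (fun i => v i ∈ A)) := by
  simp [Finset.disjoint_left]

/-- A configuration in which every set of points contains a member or is disjoint from one. -/
def IsBlocking {m : ℕ} (E : Finset (Finset (Fin m))) : Prop :=
  ∀ X : Finset (Fin m), (∃ L ∈ E, L ⊆ X) ∨ ∃ L ∈ E, Disjoint L X

theorem isBlocking_fanoFin : IsBlocking fanoFin := by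
  unfold IsBlocking
  decide +kernel

theorem isBlocking_designFin : IsBlocking designFin := by
  unfold IsBlocking
  decide +kernel

theorem exists_map_subset_or_disjoint {n m : ℕ} {E : Finset (Finset (Fin m))}
    (hE : IsBlocking E) (v : Fin m ↪ Fin n) (A : Finset (Fin n)) :
    (∃ L ∈ E, L.map v ⊆ A) ∨ ∃ L ∈ E, Disjoint (L.map v) A := by
  simp only [map_subset_iff_subset_filter, disjoint_map_iff_disjoint_filter]
  exact hE _

theorem isSaturated_familyAbove {n m k : ℕ} {E : Finset (Finset (Fin m))} (hE : IsBlocking E)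
    (hk : ∀ L ∈ E, L.card ≤ k) (hn : 2 * k ≤ n) (v : Fin m ↪ Fin n) :
    IsSaturated k (familyAbove k v E) := by
  intro A hA hint
  rw [mem_familyAbove]
  refine ⟨hA, (exists_map_subset_or_disjoint hE v A).resolve_right ?_⟩
  rintro ⟨L, hL, hLA⟩
  obtain ⟨B, hLB, hBA, hB⟩ : ∃ B, L.map v ⊆ B ∧ B ⊆ Finset.univ \ A ∧ B.card = k := by
    apply Finset.exists_subsuperset_card_eq
    · intro x hx
      simp only [Finset.mem_sdiff, Finset.mem_univ, true_and]
      exact Finset.disjoint_left.mp hLA hx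
    · rw [Finset.card_map]; exact hk L hL
    · rw [Finset.card_sdiff_of_subset (Finset.subset_univ _), Finset.card_univ, Fintype.card_fin]
      omega
  have hBF : B ∈ familyAbove k v E := mem_familyAbove.mpr ⟨hB, L, hL, hLB⟩
  exact hint (a := A) (by simp) (b := B) (by simp [hBF])
    (Finset.disjoint_of_subset_right hBA Finset.disjoint_sdiff)

/-- In a saturated family every `k`-set above a transversal is a member. -/
theorem IsSaturated.mem_of_isTransversal_subset {n k : ℕ} {F : Finset (Finset (Fin n))}
    (hsat : IsSaturated k F) (hint : (F : Set (Finset (Fin n))).Intersecting)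
    {T A : Finset (Fin n)} (hT : IsTransversal F T) (hne : T.Nonempty) (hTA : T ⊆ A)
    (hA : A.card = k) : A ∈ F := by
  have hAt := hT.mono hTA
  apply hsat A hA
  intro B hB C hC
  simp only [Finset.coe_insert, Set.mem_insert_iff, Finset.mem_coe] at hB hC
  rcases hB with rfl | hB <;> rcases hC with rfl | hC
  · rw [disjoint_self]
    exact (hne.mono hTA).ne_empty
  · exact fun h => hAt _ hC h.symm
  · exact hAt _ hB
  · exact hint hB hC

theorem eq_familyAbove_of_isTransversal {n m k : ℕ} {E : Finset (Finset (Fin m))}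
    (hE : IsBlocking E) (hne : ∀ L ∈ E, L.Nonempty) {F : Finset (Finset (Fin n))}
    (hunif : (F : Set (Finset (Fin n))).Sized k)
    (hint : (F : Set (Finset (Fin n))).Intersecting) (hsat : IsSaturated k F)
    {v : Fin m ↪ Fin n} (hv : ∀ L ∈ E, IsTransversal F (L.map v)) : F = familyAbove k v E := by
  ext A
  rw [mem_familyAbove]
  constructor
  · intro hA
    refine ⟨hunif hA, (exists_map_subset_or_disjoint hE v A).resolve_right ?_⟩
    rintro ⟨L, hL, hLA⟩
    exact hv L hL A hA hLA.symm
  · rintro ⟨hA, L, hL, hLA⟩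
    exact hsat.mem_of_isTransversal_subset hint (hv L hL) ((hne L hL).map) hLA hA

/-! ### Double diversity -/

theorem diversity_le_card_avoiding {n l : ℕ} (F : Finset (Finset (Fin n))) {S : Finset (Fin n)}
    (hS : S.card = l) : diversity l F ≤ (avoiding F S).card :=
  Nat.sInf_le ⟨S, hS, rfl⟩

theorem exists_card_avoiding_eq_diversity {n l : ℕ} (hl : l ≤ n) (F : Finset (Finset (Fin n))) :
    ∃ S : Finset (Fin n), S.card = l ∧ (avoiding F S).card = diversity l F := by
  have hne : {m : ℕ | ∃ S : Finset (Fin n), S.card = l ∧ m = (avoiding F S).card}.Nonempty := by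
    obtain ⟨S, -, hS⟩ := Finset.exists_subset_card_eq (s := (Finset.univ : Finset (Fin n)))
      (n := l) (by simpa using hl)
    exact ⟨_, S, hS, rfl⟩
  obtain ⟨S, hS, h⟩ := Nat.sInf_mem hne
  exact ⟨S, hS, h.symm⟩

theorem diversity_mono {n l : ℕ} (hl : l ≤ n) {F G : Finset (Finset (Fin n))} (h : F ⊆ G) :
    diversity l F ≤ diversity l G := by
  obtain ⟨S, hS, hG⟩ := exists_card_avoiding_eq_diversity hl G
  rw [← hG]
  exact (diversity_le_card_avoiding F hS).trans
    (Finset.card_le_card (Finset.filter_subset_filter _ h))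

/-- The number of `k`-sets that avoid the pair `S` and contain one of two triples. -/
theorem card_filter_superset_or {n k : ℕ} {L₁ L₂ S : Finset (Fin n)} (h1 : L₁.card = 3)
    (h2 : L₂.card = 3) (hS : S.card = 2) (hd1 : Disjoint L₁ S) (hd2 : Disjoint L₂ S) :
    (((Finset.powersetCard k Finset.univ).filter
      (fun A => (L₁ ⊆ A ∨ L₂ ⊆ A) ∧ Disjoint A S)).card : ℤ) =
      2 * binom (n - 5) ((k : ℤ) - 3) -
        binom (n - ((L₁ ∪ L₂).card + 2)) ((k : ℤ) - (L₁ ∪ L₂).card) := by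
  have e1 := card_filter_superset_disjoint_eq_binom (k := k) L₁ S hd1
  have e2 := card_filter_superset_disjoint_eq_binom (k := k) L₂ S hd2
  have e3 := card_filter_superset_disjoint_eq_binom (k := k) (L₁ ∪ L₂) S
    (Finset.disjoint_union_left.mpr ⟨hd1, hd2⟩)
  rw [h1, hS] at e1
  rw [h2, hS] at e2
  rw [hS] at e3
  have hu : (Finset.powersetCard k Finset.univ).filter
      (fun A => (L₁ ⊆ A ∨ L₂ ⊆ A) ∧ Disjoint A S) =
      (Finset.powersetCard k Finset.univ).filter (fun A => L₁ ⊆ A ∧ Disjoint A S) ∪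
      (Finset.powersetCard k Finset.univ).filter (fun A => L₂ ⊆ A ∧ Disjoint A S) := by
    rw [← Finset.filter_or]
    exact Finset.filter_congr fun A _ => by tauto
  have hi : (Finset.powersetCard k Finset.univ).filter
        (fun A => L₁ ∪ L₂ ⊆ A ∧ Disjoint A S) =
      (Finset.powersetCard k Finset.univ).filter (fun A => L₁ ⊆ A ∧ Disjoint A S) ∩
      (Finset.powersetCard k Finset.univ).filter (fun A => L₂ ⊆ A ∧ Disjoint A S) := by
    rw [← Finset.filter_and]
    exact Finset.filter_congr fun A _ => by rw [Finset.union_subset_iff]; tauto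
  have := Finset.card_union_add_card_inter
    ((Finset.powersetCard k Finset.univ).filter (fun A => L₁ ⊆ A ∧ Disjoint A S))
    ((Finset.powersetCard k Finset.univ).filter (fun A => L₂ ⊆ A ∧ Disjoint A S))
  rw [← hu, ← hi] at this
  push_cast at e1 e2 e3 ⊢
  linarith

/-- Two members of `E` on the points outside a pair bound the number of members of `familyAbove`
avoiding the pair from below. -/
theorem le_card_avoiding_familyAbove {n m k : ℕ} {E : Finset (Finset (Fin m))}
    (v : Fin m ↪ Fin n) {L₁ L₂ : Finset (Fin m)} {S : Finset (Fin n)} (hL₁ : L₁ ∈ E)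
    (hL₂ : L₂ ∈ E) (h1 : L₁.card = 3) (h2 : L₂.card = 3) (hS : S.card = 2)
    (hd1 : Disjoint (L₁.map v) S) (hd2 : Disjoint (L₂.map v) S) :
    2 * binom (n - 5) ((k : ℤ) - 3) - binom (n - ((L₁ ∪ L₂).card + 2)) ((k : ℤ) - (L₁ ∪ L₂).card)
      ≤ (avoiding (familyAbove k v E) S).card := by
  have h := card_filter_superset_or (k := k) ((Finset.card_map v).trans h1)
    ((Finset.card_map v).trans h2) hS hd1 hd2
  rw [← Finset.map_union, Finset.card_map] at h
  rw [← h]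
  norm_cast
  apply Finset.card_le_card
  intro A hA
  rw [Finset.mem_filter, Finset.mem_powersetCard] at hA
  rw [avoiding, Finset.mem_filter, mem_familyAbove]
  exact ⟨⟨hA.1.2, hA.2.1.elim (fun h => ⟨L₁, hL₁, h⟩) fun h => ⟨L₂, hL₂, h⟩⟩, hA.2.2⟩

/-- If only two members of `E` avoid the pair `S₀`, the bound is attained at the image of `S₀`. -/
theorem card_avoiding_familyAbove_map_le {n m k : ℕ} {E : Finset (Finset (Fin m))}
    (v : Fin m ↪ Fin n) {L₁ L₂ S₀ : Finset (Fin m)} (h1 : L₁.card = 3) (h2 : L₂.card = 3)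
    (hS : S₀.card = 2) (hd1 : Disjoint L₁ S₀) (hd2 : Disjoint L₂ S₀)
    (honly : ∀ L ∈ E, Disjoint L S₀ → L = L₁ ∨ L = L₂) :
    ((avoiding (familyAbove k v E) (S₀.map v)).card : ℤ) ≤
      2 * binom (n - 5) ((k : ℤ) - 3) -
        binom (n - ((L₁ ∪ L₂).card + 2)) ((k : ℤ) - (L₁ ∪ L₂).card) := by
  have h := card_filter_superset_or (k := k) ((Finset.card_map v).trans h1)
    ((Finset.card_map v).trans h2) ((Finset.card_map v).trans hS)
    ((Finset.disjoint_map v).mpr hd1) ((Finset.disjoint_map v).mpr hd2)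
  rw [← Finset.map_union, Finset.card_map] at h
  rw [← h]
  norm_cast
  apply Finset.card_le_card
  intro A hA
  rw [avoiding, Finset.mem_filter, mem_familyAbove] at hA
  rw [Finset.mem_filter, Finset.mem_powersetCard]
  obtain ⟨⟨hk, L, hL, hLA⟩, hAS⟩ := hA
  refine ⟨⟨Finset.subset_univ _, hk⟩, ?_, hAS⟩
  have hd : Disjoint L S₀ := (Finset.disjoint_map v).mp (Finset.disjoint_of_subset_left hLA hAS)
  rcases honly L hL hd with rfl | rfl
  · exact Or.inl hLA
  · exact Or.inr hLA

theorem card_filter_apply_mem_le {n m : ℕ} (v : Fin m ↪ Fin n) (S : Finset (Fin n)) :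
    (Finset.univ.filter (fun i => v i ∈ S)).card ≤ S.card := by
  rw [← Finset.card_map v]
  apply Finset.card_le_card
  intro x hx
  simp only [Finset.mem_map, Finset.mem_filter, Finset.mem_univ, true_and] at hx
  obtain ⟨i, hi, rfl⟩ := hx
  exact hi

theorem fanoFin_card : ∀ L ∈ fanoFin, L.card = 3 := by decide +kernel

theorem designFin_card : ∀ L ∈ designFin, L.card = 3 := by decide +kernel

theorem exists_fanoFin_disjoint : ∀ X : Finset (Fin 7), X.card ≤ 2 → ∃ L₁ ∈ fanoFin, ∃ L₂ ∈ fanoFin,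
    (L₁ ∪ L₂).card = 5 ∧ Disjoint L₁ X ∧ Disjoint L₂ X := by
  decide +kernel

theorem exists_designFin_disjoint : ∀ X : Finset (Fin 6), X.card ≤ 2 → ∃ L₁ ∈ designFin,
    ∃ L₂ ∈ designFin, (L₁ ∪ L₂).card = 4 ∧ Disjoint L₁ X ∧ Disjoint L₂ X := by
  decide +kernel

theorem diversity_familyAbove_fanoFin {n k : ℕ} (v : Fin 7 ↪ Fin n) :
    (diversity 2 (familyAbove k v fanoFin) : ℤ) =
      2 * binom (n - 5) ((k : ℤ) - 3) - binom (n - 7) ((k : ℤ) - 5) := by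
  have hn : 7 ≤ n := by simpa using Fintype.card_le_of_embedding v
  apply le_antisymm
  · have h := card_avoiding_familyAbove_map_le (k := k) (E := fanoFin) v (L₁ := {2, 4, 5})
      (L₂ := {2, 3, 6}) (S₀ := {0, 1}) (by decide) (by decide) (by decide) (by decide) (by decide)
      (by decide +kernel)
    rw [show (({2, 4, 5} : Finset (Fin 7)) ∪ {2, 3, 6}).card = 5 by decide] at h
    refine le_trans ?_ h
    exact_mod_cast diversity_le_card_avoiding _ ((Finset.card_map v).trans (by decide))
  · obtain ⟨S, hS, h⟩ := exists_card_avoiding_eq_diversity (l := 2)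
      (by omega)
      (familyAbove k v fanoFin)
    obtain ⟨L₁, hL₁, L₂, hL₂, hu, hd1, hd2⟩ := exists_fanoFin_disjoint _
      ((card_filter_apply_mem_le v S).trans hS.le)
    have := le_card_avoiding_familyAbove (k := k) v hL₁ hL₂ (fanoFin_card _ hL₁)
      (fanoFin_card _ hL₂) hS ((disjoint_map_iff_disjoint_filter v _ _).mpr hd1)
      ((disjoint_map_iff_disjoint_filter v _ _).mpr hd2)
    rw [hu] at this
    rw [← h]
    exact_mod_cast this

theorem diversity_familyAbove_designFin {n k : ℕ} (v : Fin 6 ↪ Fin n) :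
    (diversity 2 (familyAbove k v designFin) : ℤ) =
      2 * binom (n - 5) ((k : ℤ) - 3) - binom (n - 6) ((k : ℤ) - 4) := by
  have hn : 6 ≤ n := by simpa using Fintype.card_le_of_embedding v
  apply le_antisymm
  · have h := card_avoiding_familyAbove_map_le (k := k) (E := designFin) v (L₁ := {2, 3, 4})
      (L₂ := {2, 3, 5}) (S₀ := {0, 1}) (by decide) (by decide) (by decide) (by decide) (by decide)
      (by decide +kernel)
    rw [show (({2, 3, 4} : Finset (Fin 6)) ∪ {2, 3, 5}).card = 4 by decide] at h
    refine le_trans ?_ h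
    exact_mod_cast diversity_le_card_avoiding _ ((Finset.card_map v).trans (by decide))
  · obtain ⟨S, hS, h⟩ := exists_card_avoiding_eq_diversity (l := 2)
      (by omega)
      (familyAbove k v designFin)
    obtain ⟨L₁, hL₁, L₂, hL₂, hu, hd1, hd2⟩ := exists_designFin_disjoint _
      ((card_filter_apply_mem_le v S).trans hS.le)
    have := le_card_avoiding_familyAbove (k := k) v hL₁ hL₂ (designFin_card _ hL₁)
      (designFin_card _ hL₂) hS ((disjoint_map_iff_disjoint_filter v _ _).mpr hd1)
      ((disjoint_map_iff_disjoint_filter v _ _).mpr hd2)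
    rw [hu] at this
    rw [← h]
    exact_mod_cast this

/-! ### Binomial estimates -/

theorem mul_choose_succ_le {n k l : ℕ} (hn : 13 * k ^ 2 ≤ n) (hl : l < k) :
    13 * k * (n - (l + 1)).choose (k - (l + 1)) ≤ (n - l).choose (k - l) := by
  obtain ⟨j, rfl⟩ : ∃ j, k = l + 1 + j := ⟨k - (l + 1), by omega⟩
  obtain ⟨i, rfl⟩ : ∃ i, n = l + 1 + i := ⟨n - (l + 1), by
    have : l + 1 ≤ 13 * (l + 1 + j) ^ 2 := by nlinarith
    omega⟩
  have e := Nat.add_one_mul_choose_eq i j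
  rw [show l + 1 + i - (l + 1) = i by omega, show l + 1 + j - (l + 1) = j by omega,
    show l + 1 + i - l = i + 1 by omega, show l + 1 + j - l = j + 1 by omega]
  have hle : 13 * (l + 1 + j) * (j + 1) ≤ i + 1 := by nlinarith
  refine Nat.le_of_mul_le_mul_right (c := j + 1) ?_ (by omega)
  rw [← e]
  calc 13 * (l + 1 + j) * i.choose j * (j + 1) = 13 * (l + 1 + j) * (j + 1) * i.choose j := by ring
    _ ≤ (i + 1) * i.choose j := Nat.mul_le_mul_right _ hle

/-- The bound `2 C(n-5, k-3) - C(n-7, k-5)` of the theorem. -/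
noncomputable def doubleDiversityBound (n k : ℕ) : ℤ :=
  2 * binom (n - 5) ((k : ℤ) - 3) - binom (n - 7) ((k : ℤ) - 5)

theorem binom_eq_choose {m k l : ℕ} (h : l ≤ k) : binom m ((k : ℤ) - l) = m.choose (k - l) := by
  unfold binom
  rw [if_neg (by omega)]
  congr 2
  omega

theorem doubleDiversityBound_three (n : ℕ) : doubleDiversityBound n 3 = 2 := by
  simp [doubleDiversityBound, binom]

theorem binom_lt_binom_succ {m k : ℕ} (hk : 4 ≤ k) (hm : k ≤ m + 4) :
    binom m ((k : ℤ) - 5) < binom (m + 1) ((k : ℤ) - 4) := by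
  have e := binom_eq_choose (m := m + 1) hk
  push_cast at e
  rw [e]
  rcases hk.eq_or_lt with rfl | hk5
  · simp [binom]
  · have e := binom_eq_choose (m := m) hk5
    push_cast at e
    rw [e]
    have h1 := Nat.choose_succ_succ' m (k - 5)
    have h2 : 0 < m.choose (k - 5 + 1) := Nat.choose_pos (by omega)
    rw [show k - 4 = k - 5 + 1 by omega, h1]
    exact_mod_cast Nat.lt_add_of_pos_right h2

/-- The bound exceeds `(24 / 13) C(n-3, k-3)`. Here `24` counts the `2 * 3 * 4` triples of the
branching over transversals with four points; for three-point transversals the estimate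
`1 + 11 / 13 = 24 / 13` comes out of one good and eleven bad triples. -/
theorem lt_doubleDiversityBound {n k : ℕ} (hk : 4 ≤ k) (hn : 13 * k ^ 2 ≤ n) :
    (24 * (n - 3).choose (k - 3) : ℤ) < 13 * doubleDiversityBound n k := by
  obtain ⟨m, rfl⟩ : ∃ m, n = m + 7 := ⟨n - 7, by
    have : 7 ≤ 13 * k ^ 2 := by nlinarith
    omega⟩
  obtain ⟨j, rfl⟩ : ∃ j, k = j + 4 := ⟨k - 4, by omega⟩
  have hj : j ≤ m := by nlinarith
  have h1 := mul_choose_succ_le hn (l := 3) (by omega)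
  have e := binom_eq_choose (m := m + 7 - 5) (show 3 ≤ j + 4 by omega)
  have hlt := binom_lt_binom_succ (m := m) hk (by omega)
  have e' := binom_eq_choose (m := m + 1) (show 4 ≤ j + 4 by omega)
  push_cast at e e' hlt
  have hpos : 0 < (m + 4).choose (j + 1) := Nat.choose_pos (by omega)
  have p1 : (m + 4).choose (j + 1) = (m + 3).choose j + (m + 3).choose (j + 1) :=
    Nat.choose_succ_succ' _ _
  have p2 : (m + 3).choose (j + 1) = (m + 2).choose j + (m + 2).choose (j + 1) :=
    Nat.choose_succ_succ' _ _
  have q1 : (m + 2).choose j ≤ (m + 3).choose j := Nat.choose_le_choose j (by omega)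
  have q2 : (m + 1).choose j ≤ (m + 3).choose j := Nat.choose_le_choose j (by omega)
  have h2 : 52 * (m + 3).choose j ≤ (m + 4).choose (j + 1) :=
    le_trans (Nat.mul_le_mul_right _ (by omega)) h1
  rw [e'] at hlt
  rw [doubleDiversityBound, show m + 7 - 5 = m + 2 by omega, show m + 7 - 7 = m by omega,
    show m + 7 - 3 = m + 4 by omega, show j + 4 - 3 = j + 1 by omega]
  push_cast
  rw [e]
  omega

/-- The products `r³ k^(r-3) C(n-r, k-r)` decrease in `r`, and already at `r = 5` they are below
`(125 / 169) C(n-3, k-3)`. -/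
theorem cube_mul_pow_mul_choose_le {n k j : ℕ} (hn : 13 * k ^ 2 ≤ n) (hj : j + 5 ≤ k) :
    169 * ((j + 5) ^ 3 * (k ^ (j + 2) * (n - (j + 5)).choose (k - (j + 5)))) ≤
      125 * (n - 3).choose (k - 3) := by
  induction j with
  | zero =>
    have h1 := mul_choose_succ_le hn (l := 3) (by omega)
    have h2 := mul_choose_succ_le hn (l := 4) (by omega)
    calc 169 * ((0 + 5) ^ 3 * (k ^ (0 + 2) * (n - (0 + 5)).choose (k - (0 + 5))))
        = 125 * (13 * k * (13 * k * (n - (4 + 1)).choose (k - (4 + 1)))) := by ring_nf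
      _ ≤ 125 * (13 * k * (n - 4).choose (k - 4)) := by gcongr
      _ ≤ _ := by gcongr
  | succ j ih =>
    refine le_trans ?_ (ih (by omega))
    have h := mul_choose_succ_le hn (l := j + 5) (by omega)
    rw [show j + 1 + 5 = j + 5 + 1 by ring]
    calc 169 * ((j + 5 + 1) ^ 3 * (k ^ (j + 1 + 2) *
          (n - (j + 5 + 1)).choose (k - (j + 5 + 1))))
        ≤ 169 * ((13 * (j + 5) ^ 3) * (k ^ (j + 1 + 2) *
          (n - (j + 5 + 1)).choose (k - (j + 5 + 1)))) := by
          gcongr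
          nlinarith [sq_nonneg j]
      _ = 169 * ((j + 5) ^ 3 * (k ^ (j + 2) * (13 * k *
          (n - (j + 5 + 1)).choose (k - (j + 5 + 1))))) := by ring
      _ ≤ _ := by gcongr

/-! ### Transversals of a saturated family -/

theorem IsSaturated.not_disjoint_of_isTransversal {n k : ℕ} {F : Finset (Finset (Fin n))}
    (hsat : IsSaturated k F) (hint : (F : Set (Finset (Fin n))).Intersecting) (hn : 2 * k ≤ n)
    {T U : Finset (Fin n)} (hT : IsTransversal F T) (hne : T.Nonempty) (hTk : T.card ≤ k)
    (hU : IsTransversal F U) (hUk : U.card ≤ k) : ¬ Disjoint T U := by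
  intro hd
  obtain ⟨A, hTA, hAU, hA⟩ : ∃ A, T ⊆ A ∧ A ⊆ Finset.univ \ U ∧ A.card = k := by
    apply Finset.exists_subsuperset_card_eq _ hTk
    · rw [Finset.card_sdiff_of_subset (Finset.subset_univ _), Finset.card_univ, Fintype.card_fin]
      omega
    · intro x hx
      simp only [Finset.mem_sdiff, Finset.mem_univ, true_and]
      exact Finset.disjoint_left.mp hd hx
  exact hU A (hsat.mem_of_isTransversal_subset hint hT hne hTA hA)
    (Finset.disjoint_of_subset_left hAU Finset.sdiff_disjoint)

theorem exists_saturated_superset {n k : ℕ} {F : Finset (Finset (Fin n))}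
    (hunif : (F : Set (Finset (Fin n))).Sized k)
    (hint : (F : Set (Finset (Fin n))).Intersecting) :
    ∃ G, F ⊆ G ∧ (G : Set (Finset (Fin n))).Sized k ∧
      (G : Set (Finset (Fin n))).Intersecting ∧ IsSaturated k G := by
  obtain ⟨G, hFG, hG⟩ := (Set.toFinite {G : Finset (Finset (Fin n)) |
    (G : Set (Finset (Fin n))).Sized k ∧ (G : Set (Finset (Fin n))).Intersecting}).exists_le_maximal
    (show F ∈ _ from ⟨hunif, hint⟩)
  refine ⟨G, hFG, hG.prop.1, hG.prop.2, fun A hA hins => ?_⟩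
  have : insert A G ∈ {G : Finset (Finset (Fin n)) |
      (G : Set (Finset (Fin n))).Sized k ∧ (G : Set (Finset (Fin n))).Intersecting} := by
    refine ⟨?_, hins⟩
    intro B hB
    simp only [Finset.coe_insert, Set.mem_insert_iff, Finset.mem_coe] at hB
    rcases hB with rfl | hB
    · exact hA
    · exact hG.prop.1 hB
  exact hG.le_of_ge this (Finset.subset_insert A G) (Finset.mem_insert_self A G)

/-- If `X` is not a transversal, one round of branching over a member of `F` disjoint from `X`
bounds the number of members that contain `X` and avoid `S`. -/
theorem card_above_le_mul_choose {n k : ℕ} {F : Finset (Finset (Fin n))}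
    (hunif : (F : Set (Finset (Fin n))).Sized k) (hint : (F : Set (Finset (Fin n))).Intersecting)
    (S : Finset (Fin n)) {X : Finset (Fin n)} (hX : ¬ IsTransversal F X) (hk : X.card + 1 ≤ k) :
    (above F S X).card ≤ k * (n - (X.card + 1)).choose (k - (X.card + 1)) := by
  simp only [IsTransversal, not_forall, not_not] at hX
  obtain ⟨G, hG, hGX⟩ := hX
  calc (above F S X).card ≤ ∑ x ∈ G \ S, (above F S (insert x X)).card :=
        card_above_le_sum fun A hA => hint hA hG
    _ ≤ ∑ x ∈ G \ S, (n - (X.card + 1)).choose (k - (X.card + 1)) := by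
        refine Finset.sum_le_sum fun x hx => ?_
        have hxX : x ∉ X := fun h => Finset.disjoint_left.mp hGX (Finset.mem_sdiff.mp hx).1 h
        have hc := Finset.card_insert_of_notMem hxX
        have := card_above_le_choose hunif S (insert x X) (by omega)
        rwa [hc] at this
    _ = (G \ S).card * (n - (X.card + 1)).choose (k - (X.card + 1)) := by
        rw [Finset.sum_const, smul_eq_mul]
    _ ≤ _ := by
        gcongr
        rw [← hunif hG]
        exact Finset.card_le_card Finset.sdiff_subset

/-- If at most one three-point transversal avoids `S`, all but one of the (at most twelve) covering
triples fail to be transversals. -/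
theorem card_avoiding_le_of_subsingleton {n k : ℕ} {F : Finset (Finset (Fin n))}
    (hk : 4 ≤ k) (hn : 13 * k ^ 2 ≤ n) (hunif : (F : Set (Finset (Fin n))).Sized k)
    (hint : (F : Set (Finset (Fin n))).Intersecting)
    (hcov : ∀ x y : Fin n, ∃ T, IsTransversal F T ∧ T.card ≤ 3 ∧ x ∉ T ∧ y ∉ T)
    (hmin : ∀ T, IsTransversal F T → 3 ≤ T.card)
    (hmeet : ∀ T U, IsTransversal F T → T.card ≤ k → IsTransversal F U → U.card ≤ k →
      ¬ Disjoint T U) {S : Finset (Fin n)}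
    (hone : ∀ T U, IsTransversal F T → T.card = 3 → Disjoint T S → IsTransversal F U →
      U.card = 3 → Disjoint U S → T = U) :
    (avoiding F S).card ≤ (n - 3).choose (k - 3) + 11 * (k * (n - 4).choose (k - 4)) := by
  have hn0 : 0 < n := lt_of_lt_of_le (by positivity) hn
  obtain ⟨T₁, hT₁, hc₁, hS₁⟩ : ∃ T, IsTransversal F T ∧ T.card ≤ 3 ∧ ¬ Disjoint T S := by
    obtain ⟨T, hT, hTc, -⟩ := hcov ⟨0, hn0⟩ ⟨0, hn0⟩
    by_cases hTS : Disjoint T S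
    · have hT3 := hmin T hT
      obtain ⟨z, hz⟩ : T.Nonempty := Finset.card_pos.mp (by omega)
      obtain ⟨U, hU, hUc, hzU, -⟩ := hcov z z
      refine ⟨U, hU, hUc, fun hUS => hzU ?_⟩
      rwa [← hone T U hT (by omega) hTS hU (by have := hmin U hU; omega) hUS]
    · exact ⟨T, hT, hTc, hTS⟩
  obtain ⟨𝒳, h𝒳, hX, hcover⟩ := exists_triples_of_card_sdiff_le_two hcov hT₁
    (fun T hT hTc => hmeet T₁ T hT₁ (by omega) hT (by omega))
    (card_sdiff_le_of_not_disjoint hS₁ hc₁)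
  have hbad : ∀ X ∈ 𝒳, ¬ IsTransversal F X →
      (above F S X).card ≤ k * (n - 4).choose (k - 4) := by
    intro X hX𝒳 hXn
    have := card_above_le_mul_choose hunif hint S hXn (by rw [(hX X hX𝒳).1]; omega)
    rwa [(hX X hX𝒳).1] at this
  refine (card_avoiding_le_sum hcover).trans ?_
  by_cases hgood : ∃ X ∈ 𝒳, IsTransversal F X
  · obtain ⟨X₀, hX₀, hX₀t⟩ := hgood
    rw [← Finset.add_sum_erase _ _ hX₀]
    gcongr
    · have := card_above_le_choose hunif S X₀ (by rw [(hX X₀ hX₀).1]; omega)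
      rwa [(hX X₀ hX₀).1] at this
    · refine (Finset.sum_le_card_nsmul _ _ (k * (n - 4).choose (k - 4)) fun X hX' => ?_).trans ?_
      · rw [Finset.mem_erase] at hX'
        refine hbad X hX'.2 fun hXt => hX'.1 ?_
        exact hone X X₀ hXt (hX X hX'.2).1 (hX X hX'.2).2 hX₀t (hX X₀ hX₀).1 (hX X₀ hX₀).2
      · rw [smul_eq_mul, Finset.card_erase_of_mem hX₀]
        gcongr
        exact Nat.sub_le_of_le_add h𝒳
  · push Not at hgood
    refine (Finset.sum_le_card_nsmul _ _ _ fun X hX' => hbad X hX' (hgood X hX')).trans ?_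
    rw [smul_eq_mul]
    have h1 := mul_choose_succ_le hn (l := 3) (by omega)
    calc 𝒳.card * (k * (n - 4).choose (k - 4)) ≤ 12 * (k * (n - 4).choose (k - 4)) := by
          gcongr
      _ ≤ _ := by
          rw [mul_assoc] at h1
          have : 13 * (k * (n - 4).choose (k - 4)) ≤ (n - 3).choose (k - 3) := h1
          omega

/-- With all transversals disjoint from `S` of size at least `r`, a cover by triples bounds the
number of members avoiding `S`. -/
theorem card_avoiding_le_of_triples {n k r c : ℕ} {F 𝒳 : Finset (Finset (Fin n))}
    (hunif : (F : Set (Finset (Fin n))).Sized k) (hint : (F : Set (Finset (Fin n))).Intersecting)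
    {S : Finset (Fin n)} (hr : r + 3 ≤ k)
    (htr : ∀ Y, IsTransversal F Y → Disjoint Y S → r + 3 ≤ Y.card) (hc : 𝒳.card ≤ c)
    (h𝒳 : ∀ X ∈ 𝒳, X.card = 3 ∧ Disjoint X S) (hcover : ∀ A ∈ avoiding F S, ∃ X ∈ 𝒳, X ⊆ A) :
    (avoiding F S).card ≤ c * (k ^ r * (n - (r + 3)).choose (k - (r + 3))) := by
  refine (card_avoiding_le_sum hcover).trans
    ((Finset.sum_le_card_nsmul _ _ (k ^ r * (n - (r + 3)).choose (k - (r + 3)))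
      fun X hX => ?_).trans ?_)
  · obtain ⟨h3, hd⟩ := h𝒳 X hX
    have := card_above_le_pow_mul_choose hunif hint S r X hd (by omega)
      (fun Y hY hYS => by have := htr Y hY hYS; omega)
    rwa [h3, add_comm 3 r] at this
  · rw [smul_eq_mul]
    gcongr

/-- A saturated family whose double diversity reaches the bound is generated by a Fano plane or,
for `k = 3`, by the design. The parameter `r` is the least size for which no pair of points meets
all transversals with at most `r` points. -/
theorem eq_familyAbove_of_doubleDiversityBound_le {n k : ℕ} (hk : 3 ≤ k) (hn : 13 * k ^ 2 ≤ n)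
    {F : Finset (Finset (Fin n))} (hunif : (F : Set (Finset (Fin n))).Sized k)
    (hint : (F : Set (Finset (Fin n))).Intersecting) (hsat : IsSaturated k F)
    (hdiv : doubleDiversityBound n k ≤ diversity 2 F) :
    (∃ v : Fin 7 ↪ Fin n, F = familyAbove k v fanoFin) ∨
      (k = 3 ∧ ∃ v : Fin 6 ↪ Fin n, F = familyAbove k v designFin) := by
  have hn2 : 2 * k ≤ n := by nlinarith
  have hn0 : 0 < n := by omega
  have hS : ∀ S : Finset (Fin n), S.card = 2 →
      doubleDiversityBound n k ≤ (avoiding F S).card := fun S hS =>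
    hdiv.trans (by exact_mod_cast diversity_le_card_avoiding F hS)
  have hpos : 0 < doubleDiversityBound n k := by
    rcases hk.eq_or_lt with rfl | hk4
    · rw [doubleDiversityBound_three]; norm_num
    · have := lt_doubleDiversityBound hk4 hn
      omega
  have hpair : ∀ T : Finset (Fin n), T.card ≤ 2 → ∃ S, T ⊆ S ∧ S.card = 2 := fun T hT =>
    Finset.exists_superset_card_eq hT (by simp; omega)
  have hne : ∀ S : Finset (Fin n), S.card = 2 → ∃ A ∈ F, Disjoint A S := by
    intro S hS2
    have h := hS S hS2
    obtain ⟨A, hA⟩ : (avoiding F S).Nonempty := Finset.card_pos.mp (by omega)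
    exact ⟨A, Finset.mem_filter.mp hA⟩
  have hmin : ∀ T, IsTransversal F T → 3 ≤ T.card := by
    intro T hT
    by_contra hlt
    obtain ⟨S, hTS, hS2⟩ := hpair T (by omega)
    obtain ⟨A, hA, hd⟩ := hne S hS2
    exact hT.mono hTS A hA hd
  have hmeet : ∀ T U, IsTransversal F T → T.card ≤ k → IsTransversal F U → U.card ≤ k →
      ¬ Disjoint T U := fun T U hT hTk hU hUk =>
    hsat.not_disjoint_of_isTransversal hint hn2 hT
      (Finset.card_pos.mp (by have := hmin T hT; omega)) hTk hU hUk
  have hcovk : ∀ x y : Fin n, ∃ T, IsTransversal F T ∧ T.card ≤ k ∧ x ∉ T ∧ y ∉ T := by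
    intro x y
    obtain ⟨S, hxy, hS2⟩ := hpair {x, y} Finset.card_le_two
    obtain ⟨A, hA, hd⟩ := hne S hS2
    exact ⟨A, fun B hB => hint hB hA, (hunif hA).le,
      fun h => Finset.disjoint_left.mp hd h (hxy (by simp)),
      fun h => Finset.disjoint_left.mp hd h (hxy (by simp))⟩
  have hex : ∃ r, ∀ x y : Fin n, ∃ T, IsTransversal F T ∧ T.card ≤ r ∧ x ∉ T ∧ y ∉ T :=
    ⟨k, hcovk⟩
  classical
  obtain ⟨r, hcov, hleast⟩ : ∃ r, (∀ x y : Fin n, ∃ T, IsTransversal F T ∧ T.card ≤ r ∧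
      x ∉ T ∧ y ∉ T) ∧ ∀ s < r, ¬ ∀ x y : Fin n, ∃ T, IsTransversal F T ∧ T.card ≤ s ∧
      x ∉ T ∧ y ∉ T := ⟨Nat.find hex, Nat.find_spec hex, fun s hs => Nat.find_min hex hs⟩
  have hr3 : 3 ≤ r := by
    obtain ⟨T, hT, hTr, -⟩ := hcov ⟨0, hn0⟩ ⟨0, hn0⟩
    exact (hmin T hT).trans hTr
  have hrk : r ≤ k := by
    by_contra hlt
    exact hleast k (by omega) hcovk
  -- a pair meeting all transversals with fewer than `r` points
  obtain ⟨S, hS2, htr⟩ : ∃ S : Finset (Fin n), S.card = 2 ∧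
      ∀ Y, IsTransversal F Y → Disjoint Y S → r ≤ Y.card := by
    have h := hleast (r - 1) (by omega)
    push Not at h
    obtain ⟨x, y, h⟩ := h
    obtain ⟨S, hxy, hS2⟩ := hpair {x, y} Finset.card_le_two
    refine ⟨S, hS2, fun Y hY hYS => ?_⟩
    by_contra hlt
    have hx : x ∉ Y := fun hx => Finset.disjoint_left.mp hYS hx (hxy (by simp))
    have hy : y ∉ Y := fun hy => Finset.disjoint_left.mp hYS hy (hxy (by simp))
    exact hy (h Y hY (by omega) hx)
  have hrcases : r = 3 ∨ r = 4 ∨ 5 ≤ r := by omega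
  rcases hrcases with rfl | rfl | hr5
  · have hdiv2 : ∀ x y : Fin n, x ≠ y →
        ∃ A ∈ {T | IsTransversal F T ∧ T.card = 3}, ∃ B ∈ {T | IsTransversal F T ∧ T.card = 3},
          A ≠ B ∧ x ∉ A ∧ y ∉ A ∧ x ∉ B ∧ y ∉ B := by
      intro x y hxy
      have hS2 : ({x, y} : Finset (Fin n)).card = 2 := Finset.card_pair hxy
      have hlarge := hS {x, y} hS2
      have hout : ∀ A : Finset (Fin n), Disjoint A {x, y} → x ∉ A ∧ y ∉ A := fun A hA =>
        ⟨fun h => Finset.disjoint_left.mp hA h (by simp),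
          fun h => Finset.disjoint_left.mp hA h (by simp)⟩
      rcases hk.eq_or_lt with rfl | hk4
      · -- for `k = 3` the members of `F` are themselves transversals with three points
        rw [doubleDiversityBound_three] at hlarge
        obtain ⟨A, hA, B, hB, hAB⟩ := Finset.one_lt_card.mp
          (show 1 < (avoiding F {x, y}).card by omega)
        rw [avoiding, Finset.mem_filter] at hA hB
        exact ⟨A, ⟨fun C hC => hint hC hA.1, hunif hA.1⟩, B, ⟨fun C hC => hint hC hB.1, hunif hB.1⟩,
          hAB, (hout A hA.2).1, (hout A hA.2).2, (hout B hB.2).1, (hout B hB.2).2⟩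
      · by_contra hno
        have hone : ∀ T U, IsTransversal F T → T.card = 3 → Disjoint T {x, y} →
            IsTransversal F U → U.card = 3 → Disjoint U {x, y} → T = U := by
          intro T U hT hT3 hTd hU hU3 hUd
          by_contra hTU
          exact hno ⟨T, ⟨hT, hT3⟩, U, ⟨hU, hU3⟩, hTU, (hout T hTd).1, (hout T hTd).2,
            (hout U hUd).1, (hout U hUd).2⟩
        have h1 := card_avoiding_le_of_subsingleton hk4 hn hunif hint hcov hmin hmeet hone
        have h2 := lt_doubleDiversityBound hk4 hn
        have h3 : 13 * k * (n - 4).choose (k - 4) ≤ (n - 3).choose (k - 3) :=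
          mul_choose_succ_le hn (l := 3) (by omega)
        rw [mul_assoc] at h3
        omega
    have hne3 : {T | IsTransversal F T ∧ T.card = 3}.Nonempty := by
      obtain ⟨T, hT, hTr, -⟩ := hcov ⟨0, hn0⟩ ⟨0, hn0⟩
      exact ⟨T, hT, le_antisymm hTr (hmin T hT)⟩
    rcases exists_fano_or_design (fun A hA => hA.2)
      (fun A hA B hB => Finset.not_disjoint_iff.mp
        (hmeet A B hA.1 (hA.2.trans_le hk) hB.1 (hB.2.trans_le hk))) hdiv2 hne3 with
      ⟨v, hv⟩ | ⟨v, hv⟩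
    · exact Or.inl ⟨v, eq_familyAbove_of_isTransversal isBlocking_fanoFin
        (fun L hL => Finset.card_pos.mp (by rw [fanoFin_card L hL]; norm_num))
        hunif hint hsat fun L hL => (hv L hL).1⟩
    · have hF := eq_familyAbove_of_isTransversal isBlocking_designFin
        (fun L hL => Finset.card_pos.mp (by rw [designFin_card L hL]; norm_num))
        hunif hint hsat fun L hL => (hv L hL).1
      rcases hk.eq_or_lt with rfl | hk4
      · exact Or.inr ⟨rfl, v, hF⟩
      · exfalso
        rw [hF, diversity_familyAbove_designFin, doubleDiversityBound] at hdiv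
        have := binom_lt_binom_succ (m := n - 7) (k := k) hk4 (by omega)
        have hn7 : 7 ≤ n := by nlinarith
        rw [show n - 7 + 1 = n - 6 by omega] at this
        omega
  · exfalso
    have h2 := lt_doubleDiversityBound hrk hn
    have h3 : 13 * k * (n - 4).choose (k - 4) ≤ (n - 3).choose (k - 3) :=
      mul_choose_succ_le hn (l := 3) (by omega)
    rw [mul_assoc] at h3
    -- a pair as above that moreover leaves at most two points of some small transversal
    obtain ⟨S, T₁, hS2, htr, hT₁, hT₁c, htwo⟩ : ∃ S T₁ : Finset (Fin n), S.card = 2 ∧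
        (∀ Y, IsTransversal F Y → Disjoint Y S → 4 ≤ Y.card) ∧ IsTransversal F T₁ ∧
        T₁.card ≤ 4 ∧ (T₁ \ S).card ≤ 2 := by
      by_cases h : ∃ T, IsTransversal F T ∧ T.card ≤ 3
      · obtain ⟨T, hT, hTc⟩ := h
        refine ⟨S, T, hS2, htr, hT, by omega, card_sdiff_le_of_not_disjoint (fun hd => ?_) hTc⟩
        have := htr T hT hd
        omega
      · push Not at h
        obtain ⟨T, hT, hTc, -⟩ := hcov ⟨0, hn0⟩ ⟨0, hn0⟩
        obtain ⟨S, hST, hS2⟩ := Finset.exists_subset_card_eq (s := T) (n := 2)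
          (by have := h T hT; omega)
        refine ⟨S, T, hS2, fun Y hY _ => h Y hY, hT, hTc, ?_⟩
        rw [Finset.card_sdiff_of_subset hST]
        omega
    obtain ⟨𝒳, hc, hX, hcover⟩ := exists_triples_of_card_sdiff_le_two hcov hT₁
      (fun T hT hTc => hmeet T₁ T hT₁ (by omega) hT (by omega)) htwo
    have h1 := card_avoiding_le_of_triples hunif hint (r := 1) hrk htr hc hX hcover
    have h4 := hS S hS2
    -- `2 * 3 * 4 = 24` triples, each in at most `k * C(n-4, k-4)` members, fall just short
    simp only [pow_one] at h1
    norm_num at h1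
    omega
  · -- for `r ≥ 5` plain branching, with at most `r` choices in each of three rounds, suffices
    exfalso
    obtain ⟨j, rfl⟩ : ∃ j, r = j + 5 := ⟨r - 5, by omega⟩
    have h2 := lt_doubleDiversityBound (show 4 ≤ k by omega) hn
    have h3 := cube_mul_pow_mul_choose_le hn hrk
    obtain ⟨T₁, hT₁, hc₁, -⟩ := hcov ⟨0, hn0⟩ ⟨0, hn0⟩
    obtain ⟨𝒳, hc, hX, hcover⟩ := exists_triples_of_branching (S := S) (s := j + 5) hcov hT₁
      (fun x _ => by
        obtain ⟨T, hT, hTc, hxT, -⟩ := hcov x x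
        exact ⟨T, hT, hxT, (Finset.card_le_card Finset.sdiff_subset).trans hTc⟩)
    have hc' : 𝒳.card ≤ (j + 5) ^ 3 := hc.trans (by
      rw [show (j + 5) ^ 3 = (j + 5) * (j + 5) * (j + 5) by ring]
      gcongr
      exact (Finset.card_le_card Finset.sdiff_subset).trans hc₁)
    have h1 := card_avoiding_le_of_triples hunif hint (r := j + 2) hrk htr hc' hX hcover
    rw [show j + 2 + 3 = j + 5 by ring] at h1
    have h4 := hS S hS2
    omega

/-! ### The maximum double diversity -/

theorem fanoLines_eq : fanoLines = fanoFin.image fun L => L.image Fin.val := by decide +kernel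

theorem designTriples_eq : designTriples = designFin.image fun L => L.image Fin.val := by
  decide +kernel

theorem mainTheorem1 (n k : ℕ) (hk : 3 ≤ k) (hn : 13 * k ^ 2 ≤ n)
    (F : Finset (Finset (Fin n)))
    (hunif : (F : Set (Finset (Fin n))).Sized k)
    (hint : (F : Set (Finset (Fin n))).Intersecting) :
    (diversity 2 F : ℤ) ≤ 2 * binom (n - 5) ((k : ℤ) - 3) - binom (n - 7) ((k : ℤ) - 5) ∧
    (4 ≤ k →
      ((IsSaturated k F ∧
        (diversity 2 F : ℤ) = 2 * binom (n - 5) ((k : ℤ) - 3) - binom (n - 7) ((k : ℤ) - 5)) ↔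
        FamilyIso F (fanoGraph n k))) ∧
    (k = 3 →
      ((IsSaturated k F ∧
        (diversity 2 F : ℤ) = 2 * binom (n - 5) ((k : ℤ) - 3) - binom (n - 7) ((k : ℤ) - 5)) ↔
        (FamilyIso F (fanoGraph n k) ∨ FamilyIso F (generatedFamily n k designTriples)))) := by
  have hn7 : 7 ≤ n := by nlinarith
  have hn2 : 2 * k ≤ n := by nlinarith
  rw [fanoGraph, fanoLines_eq, designTriples_eq, familyIso_generatedFamily_iff hn7,
    familyIso_generatedFamily_iff (show 6 ≤ n by omega)]
  have hfano : (∃ v : Fin 7 ↪ Fin n, F = familyAbove k v fanoFin) → IsSaturated k F ∧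
      (diversity 2 F : ℤ) = 2 * binom (n - 5) ((k : ℤ) - 3) - binom (n - 7) ((k : ℤ) - 5) := by
    rintro ⟨v, rfl⟩
    exact ⟨isSaturated_familyAbove isBlocking_fanoFin
      (fun L hL => (fanoFin_card L hL).trans_le hk) hn2 v, diversity_familyAbove_fanoFin v⟩
  refine ⟨?_, ?_, ?_⟩
  · obtain ⟨G, hFG, hGu, hGi, hGs⟩ := exists_saturated_superset hunif hint
    have hmono : (diversity 2 F : ℤ) ≤ diversity 2 G := by
      exact_mod_cast diversity_mono (by omega) hFG
    refine hmono.trans ?_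
    by_contra hlt
    rcases eq_familyAbove_of_doubleDiversityBound_le hk hn hGu hGi hGs (not_le.mp hlt).le with
      ⟨v, rfl⟩ | ⟨rfl, v, rfl⟩
    · exact hlt (diversity_familyAbove_fanoFin v).le
    · rw [diversity_familyAbove_designFin] at hlt
      simp [binom] at hlt
  · intro hk4
    refine ⟨fun ⟨hsat, heq⟩ => ?_, hfano⟩
    rcases eq_familyAbove_of_doubleDiversityBound_le hk hn hunif hint hsat heq.ge with h | ⟨h, -⟩
    · exact h
    · omega
  · rintro rfl
    constructor
    · rintro ⟨hsat, heq⟩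
      rcases eq_familyAbove_of_doubleDiversityBound_le hk hn hunif hint hsat heq.ge with h | ⟨-, h⟩
      · exact Or.inl h
      · exact Or.inr h
    · rintro (h | ⟨v, rfl⟩)
      · exact hfano h
      · refine ⟨isSaturated_familyAbove isBlocking_designFin
          (fun L hL => (designFin_card L hL).le) hn2 v, ?_⟩
        rw [diversity_familyAbove_designFin]
        simp [binom]
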